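/- Let $n\ge 0$ and let $B_n$ be the group of permutations $\pi$ of $\{-n,\dots,-1,0,1,\dots,n\}$ with $\pi(-i)=-\pi(i)$ for all $i$. For $\pi\in B_n$ put $\mathrm{Des}(\pi)=\{0\le i\le n-1 : \pi(i)>\pi(i+1)\}$. For $I\subseteq\{0,1,\dots,n-1\}$ let $$F^B_I=\sum_{\substack{0=i_0\le i_1\le\dots\le i_n\\ j\in I\Rightarrow i_j<i_{j+1}}}x_{i_1}x_{i_2}\cdots x_{i_n}$$ be Chow's type B fundamental quasisymmetric function, a formal power series in commuting variables $x_0,x_1,x_2,\dots$, and for $\mathcal B\subseteq B_n$ put $\mathcal Q(\mathcal B)=\sum_{\pi\in\mathcal B}F^B_{\mathrm{Des}(\pi)}$. Let $\mathcal P^0(n)$ be the set of partitions of $2n$ whose Young diagram can be tiled by dominoes ($2\times1$ or $1\times2$ rectangles), i.e. the partitions of $2n$ with empty $2$-core. For $\lambda\in\mathcal P^0(n)$, a semistandard domino tableau $T$ of shape $\lambda$ is a tiling of the Young diagram of $\lambda$ by horizontal and vertical dominoes labelled by integers in $\{0,1,2,\dots\}$ such that labels are non-decreasing along the rows and, from one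 domino to another, strictly increasing down the columns, and such that the domino covering the top left cell, if vertical, is not labelled $0$. Let $X^T=\prod_{i\ge0}x_i^{\mu_i}$, where $\mu_i$ is the number of dominoes of $T$ labelled $i$, and define the domino function $\mathcal G_\lambda=\sum_T X^T$, the sum over all semistandard domino tableaux of shape $\lambda$. A set $\mathcal B\subseteq B_n$ is called $\mathcal G$-positive if $\mathcal Q(\mathcal B)=\sum_{\lambda\in\mathcal P^0(n)}c_\lambda\,\mathcal G_\lambda$ for some non-negative integers $c_\lambda$. **Proposition (Inverse Descent Classes).** For every $J\subseteq\{0\}\cup\{1,\dots,n\}$, the inverse descent class $\{\pi\in B_n : \mathrm{Des}(\pi^{-1})=J\}$ is $\mathcal G$-positive. -/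

import Mathlib

namespace TypeB

/-! ### Signed permutations and descents -/

/-- The hyperoctahedral group `B_n`: the permutations `π` of `{-n, …, -1, 0, 1, …, n}` such that
`π (-i) = -π i` for all `i`. -/
def SignedPerm (n : ℕ) : Subgroup (Equiv.Perm (Set.Icc (-(n : ℤ)) (n : ℤ))) where
  carrier := {π | ∀ i j : Set.Icc (-(n : ℤ)) (n : ℤ), (j : ℤ) = -(i : ℤ) → ((π j : ℤ) = -(π i : ℤ))}
  one_mem' := fun _ _ h => h
  mul_mem' := fun ha hb i j h => ha _ _ (hb i j h)
  inv_mem' := by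
    intro π hπ i j h
    have hm : -((π⁻¹ i : Set.Icc (-(n : ℤ)) (n : ℤ)) : ℤ) ∈ Set.Icc (-(n : ℤ)) (n : ℤ) := by
      have h1 := (π⁻¹ i).2.1
      have h2 := (π⁻¹ i).2.2
      constructor <;> linarith
    have h3 := hπ (π⁻¹ i) ⟨_, hm⟩ rfl
    have h5 : π (π⁻¹ i) = i := Equiv.apply_symm_apply π i
    rw [h5] at h3
    have h4 : j = π ⟨_, hm⟩ := Subtype.ext (h.trans h3.symm)
    rw [h4]
    exact congrArg Subtype.val (Equiv.symm_apply_apply π ⟨_, hm⟩)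

/-- The integer `k ∈ {0, 1, …, n}` as an element of `{-n, …, n}`. -/
def pos {n : ℕ} (k : Fin (n + 1)) : Set.Icc (-(n : ℤ)) (n : ℤ) :=
  ⟨(k : ℕ), by have := k.2; constructor <;> omega⟩

/-- The descent set `Des π = {0 ≤ i ≤ n - 1 | π i > π (i + 1)}`. -/
def des {n : ℕ} (π : SignedPerm n) : Finset ℕ :=
  (Finset.univ.filter fun i : Fin n =>
    ((π.1 (pos i.castSucc) : ℤ) > (π.1 (pos i.succ) : ℤ))).map Fin.valEmbedding

/-- The inverse descent class `{π ∈ B_n | Des (π⁻¹) = J}`. -/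
def inverseDescentClass (n : ℕ) (J : Finset ℕ) : Set (SignedPerm n) :=
  {π | des π⁻¹ = J}

/-! ### Chow's type B fundamental quasisymmetric functions -/

/-- The sequences `0 = i_0 ≤ i_1 ≤ … ≤ i_n` with `i_j < i_{j+1}` for `j ∈ I` and
`x_{i_1} ⋯ x_{i_n} = X ^ μ`. -/
def chowSeq (n : ℕ) (I : Finset ℕ) (μ : ℕ →₀ ℕ) : Set (Fin (n + 1) → ℕ) :=
  {i | i 0 = 0 ∧ (∀ j : Fin n, i j.castSucc ≤ i j.succ) ∧
    (∀ j : Fin n, (j : ℕ) ∈ I → i j.castSucc < i j.succ) ∧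
    ∑ j : Fin n, Finsupp.single (i j.succ) 1 = μ}

theorem chowSeq_finite (n : ℕ) (I : Finset ℕ) (μ : ℕ →₀ ℕ) : (chowSeq n I μ).Finite := by
  have hfin : (Set.univ.pi fun _ : Fin (n + 1) => ((insert 0 μ.support : Finset ℕ) : Set ℕ)).Finite :=
    Set.Finite.pi fun _ => Finset.finite_toSet _
  refine hfin.subset ?_
  rintro i ⟨h0, -, -, hμ⟩ j -
  refine Fin.cases ?_ (fun k => ?_) j
  · simp [h0]
  · have : μ (i k.succ) ≠ 0 := by
      rw [← hμ, Finsupp.finsetSum_apply]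
      refine Nat.ne_of_gt (Finset.sum_pos' (fun _ _ => Nat.zero_le _) ⟨k, Finset.mem_univ _, ?_⟩)
      simp
    simp [this]

/-- `F^B_I`, the formal power series in `x_0, x_1, x_2, …` which is the sum of
`x_{i_1} x_{i_2} ⋯ x_{i_n}` over all `0 = i_0 ≤ i_1 ≤ … ≤ i_n` with `i_j < i_{j+1}` for `j ∈ I`. -/
noncomputable def chowF (n : ℕ) (I : Finset ℕ) : MvPowerSeries ℕ ℂ :=
  fun μ => ((chowSeq n I μ).ncard : ℂ)

/-- The type B quasisymmetric function of a set of signed permutations, the sum of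
`F^B_{Des π}` over `π ∈ B`. -/
noncomputable def quasi {n : ℕ} (B : Set (SignedPerm n)) : MvPowerSeries ℕ ℂ :=
  ∑ π ∈ (Set.toFinite B).toFinset, chowF n (des π)

/-! ### Domino tableaux and domino functions -/

/-- A domino in the quarter plane, given by its top left cell `(row, col)` and its orientation. -/
abbrev Domino : Type := (ℕ × ℕ) × Bool

namespace Domino

/-- Whether the domino is vertical. -/
def IsVertical (d : Domino) : Prop := d.2 = true

/-- The two cells covered by a domino. Cells are pairs (row, column), rows going down. -/
def cells (d : Domino) : Finset (ℕ × ℕ) :=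
  if d.2 then {(d.1.1, d.1.2), (d.1.1 + 1, d.1.2)} else {(d.1.1, d.1.2), (d.1.1, d.1.2 + 1)}

theorem fst_mem_cells (d : Domino) : d.1 ∈ d.cells := by
  unfold cells; split <;> simp

end Domino

/-- `S` is a tiling of the Young diagram `lam` by dominoes. -/
def IsDominoTiling (lam : YoungDiagram) (S : Finset Domino) : Prop :=
  (∀ d ∈ S, d.cells ⊆ lam.cells) ∧ ∀ c ∈ lam.cells, ∃! d, d ∈ S ∧ c ∈ d.cells

/-- The set `P⁰(n)` of partitions of `2n` whose Young diagram can be tiled by dominoes, i.e. the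
partitions of `2n` with empty 2-core. -/
def P0 (n : ℕ) : Set YoungDiagram :=
  {lam | lam.card = 2 * n ∧ ∃ S, IsDominoTiling lam S}

/-- A semistandard domino tableau of shape `lam`, as a finite set of labelled dominoes `(d, l)`:
the dominoes tile `lam` (each cell lies in exactly one labelled domino), labels are non-decreasing
along the rows and strictly increasing down the columns (from one domino to another), and a vertical
domino at the top left corner is not labelled `0`. -/
structure IsSSDT (lam : YoungDiagram) (T : Finset (Domino × ℕ)) : Prop where
  inside : ∀ p ∈ T, p.1.cells ⊆ lam.cells
  cover : ∀ c ∈ lam.cells, ∃! p, p ∈ T ∧ c ∈ p.1.cells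
  row_le : ∀ p ∈ T, ∀ q ∈ T, ∀ i j k : ℕ,
    (i, j) ∈ p.1.cells → (i, k) ∈ q.1.cells → j < k → p.2 ≤ q.2
  col_lt : ∀ p ∈ T, ∀ q ∈ T, p ≠ q → ∀ i j k : ℕ,
    (i, k) ∈ p.1.cells → (j, k) ∈ q.1.cells → i < j → p.2 < q.2
  corner : ∀ p ∈ T, (0, 0) ∈ p.1.cells → p.1.IsVertical → p.2 ≠ 0

/-- The weight of a tableau: `weight T i` is the number of dominoes labelled `i`. -/
noncomputable def weight (T : Finset (Domino × ℕ)) : ℕ →₀ ℕ :=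
  ∑ p ∈ T, Finsupp.single p.2 1

/-- The semistandard domino tableaux of shape `lam` and weight `μ`. -/
def SSDT (lam : YoungDiagram) (μ : ℕ →₀ ℕ) : Set (Finset (Domino × ℕ)) :=
  {T | IsSSDT lam T ∧ weight T = μ}

theorem SSDT_finite (lam : YoungDiagram) (μ : ℕ →₀ ℕ) : (SSDT lam μ).Finite := by
  refine (Finset.finite_toSet
    ((lam.cells ×ˢ (Finset.univ : Finset Bool)) ×ˢ μ.support).powerset).subset ?_
  rintro T ⟨hT, hμ⟩
  rw [Finset.mem_coe, Finset.mem_powerset]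
  intro p hp
  have h1 : p.1.1 ∈ lam.cells := hT.inside p hp (Domino.fst_mem_cells p.1)
  have h2 : μ p.2 ≠ 0 := by
    rw [← hμ, weight, Finsupp.finsetSum_apply]
    refine Nat.ne_of_gt (Finset.sum_pos' (fun _ _ => Nat.zero_le _) ⟨p, hp, ?_⟩)
    simp
  simp only [Finset.mem_product, Finset.mem_univ, and_true, Finsupp.mem_support_iff]
  exact ⟨h1, h2⟩

/-- The domino function `G_lam`, the formal power series in `x_0, x_1, x_2, …` which is the sum of
`X ^ weight T` over all semistandard domino tableaux `T` of shape `lam`. -/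
noncomputable def dominoFunction (lam : YoungDiagram) : MvPowerSeries ℕ ℂ :=
  fun μ => ((SSDT lam μ).ncard : ℂ)

/-- A set `B` of signed permutations in `B_n` is `G`-positive (type B Schur positive) if its type B
quasisymmetric function is a finite sum of domino functions `G_lam`, `lam ∈ P⁰(n)`, with
coefficients which are non-negative integers. -/
def GPositive {n : ℕ} (B : Set (SignedPerm n)) : Prop :=
  ∃ c : YoungDiagram →₀ ℕ, (∀ lam ∈ c.support, lam ∈ P0 n) ∧
    quasi B = ∑ lam ∈ c.support, (c lam : ℂ) • dominoFunction lam

end TypeB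

/-! Fix `m` and keep only the variables x_0, …, x_m. A signed permutation π with Des(π⁻¹) = J,
together with an index sequence i of F^B_{Des π}, is encoded by the word whose letter at position
|π(k)| is i_k with the sign of π(k). This is standardization of signed words (`bijOn_extendedWord`).
It turns Q of the inverse descent class into the generating function of the words in {-m, …, m} with
descent set J, a letter 0 being put in front and the letter j weighing x_|j|.

Words are then traded for standard bitableaux without any insertion algorithm. Both are paths in a
labelled graph with a notion of ascent. By inclusion-exclusion, the sums over paths with prescribed
descents are determined by the paths cut freely into ascending runs (`PathSystem.pathSum_eq`). A run
of k letters after a free cut multiplies the end function by h_k of the whole alphabet, obviously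
for words and by the Pieri rule (`sum_upperStrips_schur`) for bitableaux; the initial run gives
h_k(x_0, …, x_m) on both sides. Hence Q is the sum of s_a(x_0, …, x_m) s_b(x_1, …, x_m) over the
standard bitableaux with descent set J, where (a, b) is the shape (`pathSum_tableauSystem_eq`).

Finally this product is the domino function of the partition with empty 2-core and 2-quotient (a, b)
(`dominoPolynomial_eq_bischur`). The dominoes with the largest label form a strip, a strip is
determined by its two shapes, and strips correspond to pairs of horizontal strips on the 2-quotients
(`rankStrip_of_interlace`, `exists_quotient_of_rankStrip`). So domino tableaux and pairs of Schur
polynomials obey the same recursion. The corner condition removes x_0 from the second factor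
(`IsStrip.corner_iff`). The coefficient of a domino function is thus a number of standard
bitableaux, which does not depend on `m`. -/

namespace TypeB

/-! ### Horizontal strips and the Pieri rule -/

/-- `ν / κ` is a horizontal strip: `ν 0 ≥ κ 0 ≥ ν 1 ≥ κ 1 ≥ …`. -/
def Interlace (κ ν : ℕ →₀ ℕ) : Prop := ∀ i, κ i ≤ ν i ∧ ν (i + 1) ≤ κ i

namespace Interlace

variable {κ ν : ℕ →₀ ℕ}

theorem le (h : Interlace κ ν) : κ ≤ ν := fun i => (h i).1

theorem antitone_left (h : Interlace κ ν) : Antitone κ :=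
  antitone_nat_of_succ_le fun i => (h (i + 1)).1.trans (h i).2

theorem antitone_right (h : Interlace κ ν) : Antitone ν :=
  antitone_nat_of_succ_le fun i => (h i).2.trans (h i).1

theorem degree_le (h : Interlace κ ν) : κ.degree ≤ ν.degree := by
  exact Finsupp.degree_mono h.le

end Interlace

/-- The sequence `a 1, a 2, …`. -/
noncomputable def seqTail (a : ℕ →₀ ℕ) : ℕ →₀ ℕ :=
  a.comapDomain Nat.succ Nat.succ_injective.injOn

/-- The sequence `c, a 0, a 1, …`. -/
noncomputable def seqCons (c : ℕ) (a : ℕ →₀ ℕ) : ℕ →₀ ℕ :=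
  Finsupp.single 0 c + a.mapDomain Nat.succ

@[simp] theorem seqTail_apply (a : ℕ →₀ ℕ) (i : ℕ) : seqTail a i = a (i + 1) := rfl

@[simp] theorem seqCons_zero (c : ℕ) (a : ℕ →₀ ℕ) : seqCons c a 0 = c := by
  simp [seqCons, Finsupp.mapDomain_of_notMem_range]

@[simp] theorem seqCons_succ (c : ℕ) (a : ℕ →₀ ℕ) (i : ℕ) : seqCons c a (i + 1) = a i := by
  simp only [seqCons, Finsupp.add_apply]
  rw [show i + 1 = Nat.succ i from rfl, Finsupp.mapDomain_apply Nat.succ_injective]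
  simp

@[simp] theorem degree_seqCons (c : ℕ) (a : ℕ →₀ ℕ) : (seqCons c a).degree = c + a.degree := by
  simp [seqCons, Finsupp.degree_mapDomain]

theorem degree_eq_head_add_tail (a : ℕ →₀ ℕ) : a.degree = a 0 + (seqTail a).degree := by
  rw [← degree_seqCons]
  congr 1
  ext i
  cases i <;> simp

theorem degree_sup_add_inf (a b : ℕ →₀ ℕ) :
    (a ⊔ b).degree + (a ⊓ b).degree = a.degree + b.degree := by
  rw [← map_add, ← map_add]
  congr 1
  ext i
  simp only [Finsupp.add_apply, Finsupp.sup_apply, Finsupp.inf_apply]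
  omega

open Classical in
/-- The partitions `κ` such that `ν / κ` is a horizontal strip. -/
noncomputable def lowerStrips (ν : ℕ →₀ ℕ) : Finset (ℕ →₀ ℕ) :=
  (Finset.Iic ν).filter (Interlace · ν)

theorem mem_lowerStrips {κ ν : ℕ →₀ ℕ} : κ ∈ lowerStrips ν ↔ Interlace κ ν := by
  simp only [lowerStrips, Finset.mem_filter, Finset.mem_Iic, and_iff_right_iff_imp]
  exact Interlace.le

open Classical in
/-- The partitions `ν` such that `ν / κ` is a horizontal strip of size `k`. -/
noncomputable def upperStrips (κ : ℕ →₀ ℕ) (k : ℕ) : Finset (ℕ →₀ ℕ) :=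
  ((insert 0 (κ.support.image Nat.succ)).finsuppAntidiag (κ.degree + k)).filter (Interlace κ)

theorem mem_upperStrips {κ ν : ℕ →₀ ℕ} {k : ℕ} :
    ν ∈ upperStrips κ k ↔ Interlace κ ν ∧ ν.degree = κ.degree + k := by
  simp only [upperStrips, Finset.mem_filter, Finset.mem_finsuppAntidiag]
  -- Since row i + 1 of `ν` is at most row i of `κ`, the finite ambient set loses no strip.
  have key : Interlace κ ν → ν.support ⊆ insert 0 (κ.support.image Nat.succ) := by
    intro h i hi
    rcases i with _ | i
    · simp
    · have := (h i).2
      have : κ i ≠ 0 := by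
        rw [Finsupp.mem_support_iff] at hi; omega
      simpa using this
  constructor
  · rintro ⟨⟨h1, h2⟩, h3⟩
    refine ⟨h3, ?_⟩
    rw [← h1, Finsupp.degree_apply]
    exact Finset.sum_subset h2 (by simp)
  · rintro ⟨h3, h1⟩
    refine ⟨⟨?_, key h3⟩, h3⟩
    rw [← h1, Finsupp.degree_apply]
    exact (Finset.sum_subset (key h3) (by simp)).symm

/-! ### Complete homogeneous and Schur polynomials -/

variable {R : Type*} [CommRing R]

/-- The complete homogeneous symmetric polynomial of degree `k` in the variables `x i`, `i ∈ s`. -/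
noncomputable def complete {ι : Type*} (x : ι → R) (s : Finset ι) (k : ℕ) : R :=
  PowerSeries.coeff k (∏ i ∈ s, PowerSeries.mk fun j => x i ^ j)

theorem complete_empty {ι : Type*} (x : ι → R) (k : ℕ) :
    complete x ∅ k = if k = 0 then 1 else 0 := by
  simp [complete, PowerSeries.coeff_one]

theorem complete_zero {ι : Type*} (x : ι → R) (s : Finset ι) : complete x s 0 = 1 := by
  simp [complete, map_prod]

theorem complete_insert {ι : Type*} [DecidableEq ι] (x : ι → R) {s : Finset ι} {a : ι} (ha : a ∉ s)
    (k : ℕ) : complete x (insert a s) k =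
      ∑ p ∈ Finset.HasAntidiagonal.antidiagonal k, x a ^ p.1 * complete x s p.2 := by
  simp [complete, Finset.prod_insert ha, PowerSeries.coeff_mul]

theorem complete_insert_succ {ι : Type*} [DecidableEq ι] (x : ι → R) {s : Finset ι} {a : ι}
    (ha : a ∉ s) (k : ℕ) : complete x (insert a s) (k + 1) =
      x a * complete x (insert a s) k + complete x s (k + 1) := by
  rw [complete_insert x ha, Finset.Nat.sum_antidiagonal_succ, complete_insert x ha,
    Finset.mul_sum, add_comm]
  simp [pow_succ', mul_assoc]

theorem complete_union {ι : Type*} [DecidableEq ι] (x : ι → R) {s t : Finset ι} (h : Disjoint s t)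
    (k : ℕ) : complete x (s ∪ t) k =
      ∑ p ∈ Finset.HasAntidiagonal.antidiagonal k, complete x s p.1 * complete x t p.2 := by
  simp [complete, Finset.prod_union h, PowerSeries.coeff_mul]

theorem complete_map {ι κ : Type*} (x : κ → R) (e : ι ↪ κ) (s : Finset ι) (k : ℕ) :
    complete x (s.map e) k = complete (fun i => x (e i)) s k := by
  simp [complete]

/-- The Schur polynomial of `ν` in the variables `x 0, …, x (m - 1)`. -/
noncomputable def schur (x : ℕ → R) : ℕ → (ℕ →₀ ℕ) → R
  | 0, ν => if ν = 0 then 1 else 0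
  | m + 1, ν => ∑ κ ∈ lowerStrips ν, x m ^ (ν.degree - κ.degree) * schur x m κ

/-- The local rule for horizontal strips: the partition below `l` and `κ` corresponding to the
partition `ν` above them. -/
noncomputable def localDown (l κ ν : ℕ →₀ ℕ) : ℕ →₀ ℕ := seqTail (l ⊔ κ) + l ⊓ κ - seqTail ν

/-- The inverse of the local rule. -/
noncomputable def localUp (l κ ρ : ℕ →₀ ℕ) (j : ℕ) : ℕ →₀ ℕ :=
  seqCons (max (l 0) (κ 0) + j) (seqTail (l ⊔ κ) + l ⊓ κ - ρ)

/-! ### The local rule on horizontal strips -/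

section LocalRule

variable {l κ ν ρ : ℕ →₀ ℕ}

theorem localDown_apply (i : ℕ) : localDown l κ ν i =
    max (l (i + 1)) (κ (i + 1)) + min (l i) (κ i) - ν (i + 1) := by
  simp [localDown, Finsupp.tsub_apply]

theorem localUp_zero (j : ℕ) : localUp l κ ρ j 0 = max (l 0) (κ 0) + j := by simp [localUp]

theorem localUp_succ (i j : ℕ) : localUp l κ ρ j (i + 1) =
    max (l (i + 1)) (κ (i + 1)) + min (l i) (κ i) - ρ i := by
  simp [localUp, Finsupp.tsub_apply]

/-- The interlacing conditions place `ν (i + 1)` in the interval from max (l (i + 1)) (κ (i + 1)) to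
min (l i) (κ i). The local rule reflects it in the midpoint, and a point of this interval is exactly
what row i of a partition below both `l` and `κ` must be. -/
theorem localDown_interlace (h : Interlace l ν) (h' : Interlace κ ν) :
    Interlace (localDown l κ ν) l ∧ Interlace (localDown l κ ν) κ := by
  constructor <;> intro i <;> rw [localDown_apply] <;>
    have := h i <;> have := h' i <;> have := h (i + 1) <;> have := h' (i + 1) <;> omega

theorem localUp_interlace (h : Interlace ρ l) (h' : Interlace ρ κ) (j : ℕ) :
    Interlace l (localUp l κ ρ j) ∧ Interlace κ (localUp l κ ρ j) := by
  constructor <;> intro i <;> rw [localUp_succ] <;>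
    rcases i with _ | i <;> simp only [localUp_zero, localUp_succ]
  all_goals
    first
      | (have := h 0; have := h' 0; have := h 1; have := h' 1; simp only [zero_add] at *; omega)
      | (have := h i; have := h' i; have := h (i + 1); have := h' (i + 1); omega)

theorem localUp_localDown (h : Interlace l ν) (h' : Interlace κ ν) :
    localUp l κ (localDown l κ ν) (ν 0 - max (l 0) (κ 0)) = ν := by
  ext i
  rcases i with _ | i
  · rw [localUp_zero]
    have := h 0; have := h' 0; omega
  · rw [localUp_succ, localDown_apply]
    have := h i; have := h' i; have := h (i + 1); have := h' (i + 1); omega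

theorem localDown_localUp (h : Interlace ρ l) (h' : Interlace ρ κ) (j : ℕ) :
    localDown l κ (localUp l κ ρ j) = ρ := by
  ext i
  rw [localDown_apply, localUp_succ]
  have := h i; have := h' i; omega

/-- Reflection preserves row sums, so only the first row of `ν`, which is not reflected, contributes
an excess. -/
theorem degree_localDown (h : Interlace l ν) (h' : Interlace κ ν) :
    (localDown l κ ν).degree + ν.degree =
      l.degree + κ.degree + (ν 0 - max (l 0) (κ 0)) := by
  have h1 : localDown l κ ν + seqTail ν = seqTail (l ⊔ κ) + l ⊓ κ := by
    ext i
    simp only [Finsupp.add_apply, localDown_apply, seqTail_apply, Finsupp.sup_apply,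
      Finsupp.inf_apply]
    have := h i; have := h' i; omega
  have h2 := congrArg Finsupp.degree h1
  rw [map_add, map_add] at h2
  have h3 := degree_eq_head_add_tail ν
  have h4 := degree_eq_head_add_tail (l ⊔ κ)
  have h5 := degree_sup_add_inf l κ
  have h6 : (l ⊔ κ) 0 = max (l 0) (κ 0) := rfl
  have := h 0; have := h' 0
  omega

end LocalRule

/-- **Pieri rule**: multiplication of a Schur polynomial by a complete homogeneous symmetric
polynomial. -/
theorem sum_upperStrips_schur (x : ℕ → R) (m : ℕ) (l : ℕ →₀ ℕ) (k : ℕ) :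
    ∑ ν ∈ upperStrips l k, schur x m ν = complete x (Finset.range m) k * schur x m l := by
  induction m generalizing l k with
  | zero =>
    simp only [schur, Finset.range_zero, complete_empty, Finset.sum_ite_eq', mem_upperStrips]
    by_cases hl : l = 0
    · subst hl
      have : Interlace 0 0 := fun i => by simp
      simp [mem_upperStrips, this, eq_comm]
    · have : ¬ Interlace l 0 := fun h => hl (le_antisymm h.le (by simp))
      simp [hl, mem_upperStrips, this]
  | succ m ih =>
    rw [Finset.range_add_one, complete_insert x (by simp)]
    simp only [schur]
    rw [Finset.sum_mul]
    have h1 : ∀ p ∈ Finset.HasAntidiagonal.antidiagonal k, x m ^ p.1 * complete x (Finset.range m) p.2 *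
        ∑ ρ ∈ lowerStrips l, x m ^ (l.degree - ρ.degree) * schur x m ρ =
        ∑ ρ ∈ lowerStrips l, ∑ κ ∈ upperStrips ρ p.2,
          x m ^ (p.1 + (l.degree - ρ.degree)) * schur x m κ := by
      intro p _
      rw [Finset.mul_sum]
      refine Finset.sum_congr rfl fun ρ _ => ?_
      rw [← Finset.mul_sum, ih]
      ring
    rw [Finset.sum_congr rfl h1]
    simp only [Finset.sum_sigma']
    -- On the left `κ` lies below `ν`, on the right it lies above `ρ`, while `l` is fixed. The local
    -- rule exchanges `ν` and `ρ`; the excess of the first row of `ν` over those of `l` and `κ`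
    -- becomes the power of `x m` taken from the complete polynomial.
    refine Finset.sum_bij' (fun q _ => ⟨(q.1 0 - max (l 0) (q.2 0),
        k - (q.1 0 - max (l 0) (q.2 0))), localDown l q.2 q.1, q.2⟩)
      (fun q _ => ⟨localUp l q.2.2 q.2.1 q.1.1, q.2.2⟩) ?_ ?_ ?_ ?_ ?_
    · rintro ⟨ν, κ⟩ hq
      simp only [Finset.mem_sigma, mem_upperStrips, mem_lowerStrips] at hq
      obtain ⟨⟨h, hd⟩, h'⟩ := hq
      obtain ⟨h2, h3⟩ := localDown_interlace h h'
      have h4 := degree_localDown h h'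
      have h5 := h2.degree_le
      have h6 := h3.degree_le
      have h7 := h'.degree_le
      simp only [Finset.mem_sigma, mem_upperStrips, mem_lowerStrips, Finset.HasAntidiagonal.mem_antidiagonal]
      exact ⟨by omega, h2, h3, by omega⟩
    · rintro ⟨⟨i, j⟩, ρ, κ⟩ hq
      simp only [Finset.mem_sigma, mem_upperStrips, mem_lowerStrips, Finset.HasAntidiagonal.mem_antidiagonal] at hq
      obtain ⟨hij, h, h', hd⟩ := hq
      obtain ⟨h2, h3⟩ := localUp_interlace h h' i
      have h4 := degree_localDown h2 h3
      rw [localDown_localUp h h', localUp_zero] at h4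
      simp only [Finset.mem_sigma, mem_upperStrips, mem_lowerStrips]
      exact ⟨⟨h2, by omega⟩, h3⟩
    · rintro ⟨ν, κ⟩ hq
      simp only [Finset.mem_sigma, mem_upperStrips, mem_lowerStrips] at hq
      obtain ⟨⟨h, hd⟩, h'⟩ := hq
      simp only [localUp_localDown h h']
    · rintro ⟨⟨i, j⟩, ρ, κ⟩ hq
      simp only [Finset.mem_sigma, mem_upperStrips, mem_lowerStrips, Finset.HasAntidiagonal.mem_antidiagonal] at hq
      obtain ⟨hij, h, h', hd⟩ := hq
      simp only [localDown_localUp h h', localUp_zero]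
      have e1 : max (l 0) (κ 0) + i - max (l 0) (κ 0) = i := by omega
      have e2 : k - i = j := by omega
      simp only [e1, e2]
    · rintro ⟨ν, κ⟩ hq
      simp only [Finset.mem_sigma, mem_upperStrips, mem_lowerStrips] at hq
      obtain ⟨⟨h, hd⟩, h'⟩ := hq
      obtain ⟨h2, h3⟩ := localDown_interlace h h'
      have h4 := degree_localDown h h'
      have h5 := h2.degree_le
      have h7 := h'.degree_le
      simp only
      congr 2
      omega

/-! ### Sums over paths with prescribed descents -/

/-- A graph whose edges are labelled by letters, together with a relation on letters which says
when two successive edges of a path form an ascent; `none` stands for the start of the path. -/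
structure PathSystem where
  State : Type
  Letter : Type
  steps : State → Finset Letter
  act : State → Letter → State
  asc : Option Letter → Letter → Prop

namespace PathSystem

/-- Whether a step is allowed by a condition: `some true` requires an ascent, `some false` a
descent, and `none` nothing. -/
def Allows (S : PathSystem) (d : Option Bool) (a : Option S.Letter) (b : S.Letter) : Prop :=
  ∀ c ∈ d, (c = true ↔ S.asc a b)

open Classical in
/-- The sum of the values of `f` at the ends of the paths from `z` which satisfy a list of
conditions, where the letter `a` precedes the path. -/
noncomputable def pathSum (S : PathSystem) {M : Type*} [AddCommMonoid M] (f : S.State → M) :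
    List (Option Bool) → Option S.Letter → S.State → M
  | [], _, z => f z
  | d :: ds, a, z => ∑ b ∈ (S.steps z).filter (S.Allows d a), pathSum S f ds (some b) (S.act z b)

variable {S : PathSystem} {M N : Type*} [AddCommMonoid M] [AddCommMonoid N]

open Classical in
theorem pathSum_cons_none (f : S.State → M) (ds : List (Option Bool)) (a : Option S.Letter)
    (z : S.State) : S.pathSum f (none :: ds) a z =
      ∑ b ∈ S.steps z, S.pathSum f ds (some b) (S.act z b) := by
  rw [pathSum]
  refine Finset.sum_congr ?_ fun _ _ => rfl
  ext b
  simp [Allows]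

open Classical in
theorem pathSum_cons_true (f : S.State → M) (ds : List (Option Bool)) (a : Option S.Letter)
    (z : S.State) : S.pathSum f (some true :: ds) a z =
      ∑ b ∈ (S.steps z).filter (S.asc a), S.pathSum f ds (some b) (S.act z b) := by
  rw [pathSum]
  refine Finset.sum_congr ?_ fun _ _ => rfl
  ext b
  simp [Allows]

open Classical in
theorem pathSum_cons_false (f : S.State → M) (ds : List (Option Bool)) (a : Option S.Letter)
    (z : S.State) : S.pathSum f (some false :: ds) a z =
      ∑ b ∈ (S.steps z).filter (¬ S.asc a ·), S.pathSum f ds (some b) (S.act z b) := by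
  rw [pathSum]
  refine Finset.sum_congr ?_ fun _ _ => rfl
  ext b
  simp [Allows]

/-- An unconstrained step does not look at the preceding letter, so the path can be cut there and
the rest absorbed into the end function. -/
theorem pathSum_append_none (f : S.State → M) (ds ds' : List (Option Bool)) (a : Option S.Letter)
    (z : S.State) : S.pathSum f (ds ++ none :: ds') a z =
      S.pathSum (S.pathSum f (none :: ds') none) ds a z := by
  induction ds generalizing a z with
  | nil =>
    rw [List.nil_append]
    exact (pathSum_cons_none f ds' a z).trans (pathSum_cons_none f ds' none z).symm
  | cons d ds ih => simp only [List.cons_append, pathSum, ih]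

theorem pathSum_append_add (f : S.State → M) (ds ds' : List (Option Bool)) (a : Option S.Letter)
    (z : S.State) : S.pathSum f (ds ++ none :: ds') a z =
      S.pathSum f (ds ++ some true :: ds') a z + S.pathSum f (ds ++ some false :: ds') a z := by
  classical
  induction ds generalizing a z with
  | nil =>
    simp only [List.nil_append, pathSum_cons_none, pathSum_cons_true, pathSum_cons_false]
    exact (Finset.sum_filter_add_sum_filter_not _ _ _).symm
  | cons d ds ih => simp only [List.cons_append, pathSum, ih, Finset.sum_add_distrib]

theorem map_pathSum (φ : M →+ N) (f : S.State → M) (ds : List (Option Bool))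
    (a : Option S.Letter) (z : S.State) :
    φ (S.pathSum f ds a z) = S.pathSum (fun w => φ (f w)) ds a z := by
  induction ds generalizing a z with
  | nil => rfl
  | cons d ds ih => simp only [pathSum, map_sum, ih]

variable {R : Type*} [CommRing R]

theorem pathSum_mul_left (c : R) (f : S.State → R) (ds : List (Option Bool))
    (a : Option S.Letter) (z : S.State) :
    S.pathSum (fun w => c * f w) ds a z = c * S.pathSum f ds a z :=
  (map_pathSum (AddMonoidHom.mulLeft c) f ds a z).symm

/-- Without required descents, the list is a sequence of ascending runs separated by unconstrained
steps. Each run acts on the end function by a scalar `h k` common to the two systems, so the whole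
list acts by a common scalar. The index `k` counts the ascents already collected in the current run.
-/
theorem exists_pathSum_eq_mul {S₁ S₂ : PathSystem} {f₁ : S₁.State → R} {f₂ : S₂.State → R}
    (h : ℕ → R)
    (H₁ : ∀ k z, S₁.pathSum f₁ (none :: List.replicate k (some true)) none z = h k * f₁ z)
    (H₂ : ∀ k z, S₂.pathSum f₂ (none :: List.replicate k (some true)) none z = h k * f₂ z)
    (ds : List (Option Bool)) (hds : some false ∉ ds) (k : ℕ) :
    ∃ e : R, (∀ z, S₁.pathSum f₁ (none :: (List.replicate k (some true) ++ ds)) none z = e * f₁ z) ∧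
      ∀ z, S₂.pathSum f₂ (none :: (List.replicate k (some true) ++ ds)) none z = e * f₂ z := by
  induction ds generalizing k with
  | nil => exact ⟨h k, by simpa using H₁ k, by simpa using H₂ k⟩
  | cons d ds ih =>
    have hds' : some false ∉ ds := fun h => hds (List.mem_cons_of_mem _ h)
    match d, hds with
    | some true, _ =>
      have e : List.replicate k (some true) ++ some true :: ds =
          List.replicate (k + 1) (some true) ++ ds := by
        rw [List.replicate_succ']; simp
      rw [e]
      exact ih hds' (k + 1)
    | some false, hds => simp at hds
    | none, _ =>
      obtain ⟨e, h1, h2⟩ := ih hds' 0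
      simp only [List.replicate_zero, List.nil_append] at h1 h2
      refine ⟨e * h k, fun z => ?_, fun z => ?_⟩
      · rw [← List.cons_append, pathSum_append_none, funext h1, pathSum_mul_left, H₁, mul_assoc]
      · rw [← List.cons_append, pathSum_append_none, funext h2, pathSum_mul_left, H₂, mul_assoc]

/-- Only the first run depends on the starting points, since it is not preceded by a free step; the
remaining runs contribute a common scalar. -/
theorem pathSum_eq_of_not_mem {S₁ S₂ : PathSystem} {f₁ : S₁.State → R} {f₂ : S₂.State → R}
    (h : ℕ → R)
    (H₁ : ∀ k z, S₁.pathSum f₁ (none :: List.replicate k (some true)) none z = h k * f₁ z)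
    (H₂ : ∀ k z, S₂.pathSum f₂ (none :: List.replicate k (some true)) none z = h k * f₂ z)
    (z₁ : S₁.State) (z₂ : S₂.State)
    (H : ∀ k, S₁.pathSum f₁ (List.replicate k (some true)) none z₁ =
      S₂.pathSum f₂ (List.replicate k (some true)) none z₂)
    (ds : List (Option Bool)) (hds : some false ∉ ds) (k : ℕ) :
    S₁.pathSum f₁ (List.replicate k (some true) ++ ds) none z₁ =
      S₂.pathSum f₂ (List.replicate k (some true) ++ ds) none z₂ := by
  induction ds generalizing k with
  | nil => simpa using H k
  | cons d ds ih =>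
    have hds' : some false ∉ ds := fun h => hds (List.mem_cons_of_mem _ h)
    match d, hds with
    | some true, _ =>
      have e : List.replicate k (some true) ++ some true :: ds =
          List.replicate (k + 1) (some true) ++ ds := by
        rw [List.replicate_succ']; simp
      rw [e]
      exact ih hds' (k + 1)
    | some false, hds => simp at hds
    | none, _ =>
      obtain ⟨e, h1, h2⟩ := exists_pathSum_eq_mul h H₁ H₂ ds hds' 0
      simp only [List.replicate_zero, List.nil_append] at h1 h2
      rw [pathSum_append_none, pathSum_append_none, funext h1, funext h2, pathSum_mul_left,
        pathSum_mul_left, H]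

/-- Two path systems in which the paths without descents have the same sums have the same sums over
paths with any prescribed descents. -/
theorem pathSum_eq {S₁ S₂ : PathSystem} {f₁ : S₁.State → R} {f₂ : S₂.State → R}
    (h : ℕ → R)
    (H₁ : ∀ k z, S₁.pathSum f₁ (none :: List.replicate k (some true)) none z = h k * f₁ z)
    (H₂ : ∀ k z, S₂.pathSum f₂ (none :: List.replicate k (some true)) none z = h k * f₂ z)
    (z₁ : S₁.State) (z₂ : S₂.State)
    (H : ∀ k, S₁.pathSum f₁ (List.replicate k (some true)) none z₁ =
      S₂.pathSum f₂ (List.replicate k (some true)) none z₂)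
    (ds : List (Option Bool)) : S₁.pathSum f₁ ds none z₁ = S₂.pathSum f₂ ds none z₂ := by
  -- The conditions are moved one by one into a prefix free of required descents, which must
  -- therefore be arbitrary in the induction.
  suffices key : ∀ ds' : List (Option Bool), some false ∉ ds' →
      S₁.pathSum f₁ (ds' ++ ds) none z₁ = S₂.pathSum f₂ (ds' ++ ds) none z₂ from
    key [] (by simp)
  induction ds with
  | nil =>
    intro ds' hds'
    simpa using pathSum_eq_of_not_mem h H₁ H₂ z₁ z₂ H ds' hds' 0
  | cons d ds ih =>
    intro ds' hds'
    have aux : ∀ c : Option Bool, c ≠ some false →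
        S₁.pathSum f₁ (ds' ++ c :: ds) none z₁ = S₂.pathSum f₂ (ds' ++ c :: ds) none z₂ := by
      intro c hc
      have := ih (ds' ++ [c]) (by
        simp only [List.mem_append, List.mem_singleton, not_or]
        exact ⟨hds', fun h => hc h.symm⟩)
      simpa using this
    by_cases hd : d = some false
    · subst hd
      -- Inclusion-exclusion: the paths with a descent here are all the paths minus those with an
      -- ascent here.
      have h1 := aux none (by simp)
      rw [pathSum_append_add, pathSum_append_add, aux (some true) (by simp)] at h1
      exact add_left_cancel h1
    · exact aux d hd

end PathSystem

/-! ### Words -/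

/-- The path system whose paths are the words in the alphabet `s`, the states being products of
weights of letters; the first letter of a word without descents is non-negative. -/
noncomputable abbrev wordSystem {R : Type} [CommRing R] (x : ℤ → R) (s : Finset ℤ) : PathSystem where
  State := R
  Letter := ℤ
  steps _ := s
  act z b := x b * z
  asc a b := a.getD 0 ≤ b

/-- A weakly increasing word is its least letter followed by a weakly increasing word in the letters
at least as large. Inserting a new minimum leaves the filters of the other letters unchanged. -/
theorem complete_succ_eq_sum {R : Type*} [CommRing R] {ι : Type*} [LinearOrder ι] (x : ι → R)
    (s : Finset ι) (k : ℕ) :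
    complete x s (k + 1) = ∑ b ∈ s, x b * complete x (s.filter (b ≤ ·)) k := by
  induction s using Finset.induction_on_min with
  | empty => simp [complete_empty]
  | insert a s ha ih =>
    have has : a ∉ s := fun h => lt_irrefl _ (ha a h)
    have h1 : (insert a s).filter (a ≤ ·) = insert a s := by
      refine Finset.filter_true_of_mem fun b hb => ?_
      rcases Finset.mem_insert.mp hb with rfl | hb
      · exact le_rfl
      · exact (ha b hb).le
    rw [complete_insert_succ x has, Finset.sum_insert has, h1, ih]
    congr 1
    refine Finset.sum_congr rfl fun b hb => ?_
    rw [Finset.filter_insert, if_neg (not_le.mpr (ha b hb))]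

section WordSystem

variable {R : Type} [CommRing R] (x : ℤ → R) (s : Finset ℤ)

/-- An ascending run after the letter `a` is a multiset of letters `≥ a`. At the start the missing
letter counts as 0, so only the non-negative letters remain. -/
theorem wordSystem_pathSum_replicate (k : ℕ) (a : Option ℤ) (z : R) :
    (wordSystem x s).pathSum (fun w : R => w) (List.replicate k (some true)) a z =
      complete x (s.filter (a.getD 0 ≤ ·)) k * z := by
  induction k generalizing a z with
  | zero =>
    rw [complete_zero, one_mul]
    rfl
  | succ k ih =>
    rw [List.replicate_succ, PathSystem.pathSum_cons_true, complete_succ_eq_sum, Finset.sum_mul]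
    refine Finset.sum_congr ?_ fun b hb => ?_
    · ext b
      simp only [Finset.mem_filter]
    · have hb' : a.getD 0 ≤ b := (Finset.mem_filter.mp hb).2
      rw [show (wordSystem x s).act z b = x b * z from rfl]
      refine (ih (some b) (x b * z)).trans ?_
      have : (s.filter (a.getD 0 ≤ ·)).filter (b ≤ ·) = s.filter ((some b).getD 0 ≤ ·) := by
        rw [Finset.filter_filter]
        refine Finset.filter_congr fun c _ => ?_
        simp only [Option.getD_some]
        exact ⟨fun h => h.2, fun h => ⟨hb'.trans h, h⟩⟩
      rw [this]
      ring

theorem wordSystem_pathSum_cons_none (k : ℕ) (z : R) :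
    (wordSystem x s).pathSum (fun w : R => w) (none :: List.replicate k (some true)) none z =
      complete x s (k + 1) * z := by
  rw [PathSystem.pathSum_cons_none, complete_succ_eq_sum, Finset.sum_mul]
  refine Finset.sum_congr rfl fun b _ => ?_
  refine (wordSystem_pathSum_replicate x s k (some b) (x b * z)).trans ?_
  simp only [Option.getD_some]
  ring

end WordSystem

/-! ### Standard tableaux -/

/-- The sequence obtained from `a` by adding a box to row `r`. -/
noncomputable def addBox (a : ℕ →₀ ℕ) (r : ℕ) : ℕ →₀ ℕ := a + Finsupp.single r 1

@[simp] theorem addBox_self (a : ℕ →₀ ℕ) (r : ℕ) : addBox a r r = a r + 1 := by simp [addBox]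

theorem addBox_of_ne (a : ℕ →₀ ℕ) {r i : ℕ} (h : i ≠ r) : addBox a r i = a i := by
  simp [addBox, Finsupp.single_eq_of_ne h]

@[simp] theorem degree_addBox (a : ℕ →₀ ℕ) (r : ℕ) : (addBox a r).degree = a.degree + 1 := by
  simp [addBox]

open Classical in
/-- The rows of a partition to which a box can be added. -/
noncomputable def addable (a : ℕ →₀ ℕ) : Finset ℕ :=
  (insert 0 (a.support.image Nat.succ)).filter fun r => Antitone (addBox a r)

theorem mem_addable {a : ℕ →₀ ℕ} {r : ℕ} :
    r ∈ addable a ↔ Antitone (addBox a r) := by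
  simp only [addable, Finset.mem_filter, and_iff_right_iff_imp]
  intro h
  rcases r with _ | r
  · simp
  · have := h (Nat.le_succ r)
    rw [Nat.succ_eq_add_one, addBox_self, addBox_of_ne a (by omega)] at this
    have : a r ≠ 0 := by omega
    simpa using this

open Classical in
/-- The partitions `ν` such that `ν / κ` is a horizontal strip of size `k` in the rows `≤ r`. -/
noncomputable def boundedStrips (r : ℕ∞) (κ : ℕ →₀ ℕ) (k : ℕ) : Finset (ℕ →₀ ℕ) :=
  (upperStrips κ k).filter fun ν => ∀ i : ℕ, r < i → ν i = κ i

theorem mem_boundedStrips {r : ℕ∞} {κ ν : ℕ →₀ ℕ} {k : ℕ} : ν ∈ boundedStrips r κ k ↔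
    (Interlace κ ν ∧ ν.degree = κ.degree + k) ∧ ∀ i : ℕ, r < i → ν i = κ i := by
  simp only [boundedStrips, Finset.mem_filter, mem_upperStrips]

theorem boundedStrips_top (κ : ℕ →₀ ℕ) (k : ℕ) : boundedStrips ⊤ κ k = upperStrips κ k := by
  ext ν
  simp [mem_boundedStrips, mem_upperStrips]

theorem interlace_self {a : ℕ →₀ ℕ} (ha : Antitone a) : Interlace a a :=
  fun i => ⟨le_rfl, ha (Nat.le_succ i)⟩

theorem Interlace.eq_of_degree_le {κ ν : ℕ →₀ ℕ} (h : Interlace κ ν) (hd : ν.degree ≤ κ.degree) :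
    ν = κ := by
  have h1 : ν = κ + (ν - κ) := (add_tsub_cancel_of_le h.le).symm
  have h2 := congrArg Finsupp.degree h1
  rw [map_add] at h2
  have h3 : (ν - κ).degree = 0 := by omega
  rw [Finsupp.degree_eq_zero_iff] at h3
  rw [h1, h3, add_zero]

theorem boundedStrips_zero (r : ℕ∞) {a : ℕ →₀ ℕ} (ha : Antitone a) : boundedStrips r a 0 = {a} := by
  ext ν
  simp only [mem_boundedStrips, Finset.mem_singleton, add_zero]
  constructor
  · rintro ⟨⟨h, hd⟩, -⟩
    exact h.eq_of_degree_le hd.le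
  · rintro rfl
    exact ⟨⟨interlace_self ha, rfl⟩, fun _ _ => rfl⟩

open Classical in
-- A horizontal strip is filled from its lowest row upwards, left to right in each row. The first
-- box goes to the lowest row `s` of the strip, and the remaining boxes lie in rows `≤ s`; this is
-- why an ascent is a weak decrease of the row index.
theorem sum_boundedStrips_succ {M : Type*} [AddCommMonoid M] (f : (ℕ →₀ ℕ) → M) (r : ℕ∞)
    {a : ℕ →₀ ℕ} (ha : Antitone a) (k : ℕ) :
    ∑ ν ∈ boundedStrips r a (k + 1), f ν = ∑ s ∈ (addable a).filter (fun s : ℕ => (s : ℕ∞) ≤ r),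
      ∑ ν ∈ boundedStrips s (addBox a s) k, f ν := by
  rw [Finset.sum_sigma']
  have key : ∀ s ν, ν ∈ boundedStrips (s : ℕ) (addBox a s) k →
      a s < ν s ∧ ∀ i, s < i → ν i = a i := by
    intro s ν h
    rw [mem_boundedStrips] at h
    constructor
    · have := (h.1.1 s).1
      rw [addBox_self] at this
      omega
    · intro i hi
      rw [h.2 i (by exact_mod_cast hi), addBox_of_ne a (by omega)]
  symm
  refine Finset.sum_bij (fun p _ => p.2) ?_ ?_ ?_ fun _ _ => rfl
  · rintro ⟨s, ν⟩ h
    simp only [Finset.mem_sigma, Finset.mem_filter] at h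
    obtain ⟨⟨hs, hsr⟩, h⟩ := h
    obtain ⟨h1, h2⟩ := key s ν h
    simp only [mem_boundedStrips] at h ⊢
    obtain ⟨⟨h3, h4⟩, h5⟩ := h
    rw [degree_addBox] at h4
    refine ⟨⟨fun i => ⟨?_, ?_⟩, by omega⟩, fun i hi => h2 i ?_⟩
    · have := (h3 i).1
      by_cases hi : i = s
      · subst hi; omega
      · rwa [addBox_of_ne a hi] at this
    · by_cases hi : i = s
      · subst hi
        rw [h2 (i + 1) (by omega)]
        exact ha (Nat.le_succ i)
      · have := (h3 i).2
        rwa [addBox_of_ne a hi] at this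
    · exact_mod_cast hsr.trans_lt hi
  · rintro ⟨s, ν⟩ h ⟨s', ν'⟩ h' e
    simp only [Finset.mem_sigma] at h h' e
    subst e
    obtain ⟨h1, h2⟩ := key s ν h.2
    obtain ⟨h1', h2'⟩ := key s' ν h'.2
    have : s = s' := by
      by_contra hne
      rcases Nat.lt_or_gt_of_ne hne with hlt | hlt
      · have := h2 s' hlt; omega
      · have := h2' s hlt; omega
    subst this
    rfl
  · intro ν h
    rw [mem_boundedStrips] at h
    obtain ⟨⟨h1, h2⟩, h3⟩ := h
    have hne : ((ν - a).support).Nonempty := by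
      rw [Finset.nonempty_iff_ne_empty, Ne, Finsupp.support_eq_empty]
      intro h0
      have : ν = a + (ν - a) := (add_tsub_cancel_of_le h1.le).symm
      rw [h0, add_zero] at this
      rw [this] at h2
      omega
    -- The row of the first box is forced to be the last row in which `ν` differs from `a`.
    set s := (ν - a).support.max' hne with hs
    have hs1 : a s < ν s := by
      have := Finset.max'_mem _ hne
      rw [← hs, Finsupp.mem_support_iff, Finsupp.tsub_apply] at this
      omega
    have hs2 : ∀ i, s < i → ν i = a i := by
      intro i hi
      by_contra hia
      have : i ∈ (ν - a).support := by
        rw [Finsupp.mem_support_iff, Finsupp.tsub_apply]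
        have := (h1 i).1
        omega
      have := Finset.le_max' _ i this
      omega
    have hint : Interlace (addBox a s) ν := by
      intro i
      by_cases hi : i = s
      · rw [hi, addBox_self]
        have := (h1 s).2
        omega
      · rw [addBox_of_ne a hi]
        exact h1 i
    refine ⟨⟨s, ν⟩, ?_, rfl⟩
    simp only [Finset.mem_sigma, Finset.mem_filter, mem_addable, mem_boundedStrips]
    refine ⟨⟨hint.antitone_left, ?_⟩, ⟨hint, ?_⟩, ?_⟩
    · by_contra hlt
      have := h3 s (not_le.mp hlt)
      omega
    · rw [degree_addBox]; omega
    · intro i hi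
      have hi' : s < i := by exact_mod_cast hi
      rw [hs2 i hi', addBox_of_ne a (by omega)]

open Classical in
/-- The path system whose paths are the standard bitableaux. The state `(a, b)` is a pair of
partitions; the letter `inl r` adds a box to row `r` of `b`, the letter `inr r` adds a box to row
`r` of `a`. -/
noncomputable abbrev tableauSystem : PathSystem where
  State := (ℕ →₀ ℕ) × (ℕ →₀ ℕ)
  Letter := ℕ ⊕ ℕ
  steps z := if Antitone z.1 ∧ Antitone z.2 then (addable z.2).disjSum (addable z.1) else ∅
  act z c := Sum.elim (fun r => (z.1, addBox z.2 r))
    (fun r => (addBox z.1 r, z.2)) c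
  asc c d := match c, d with
    | none, Sum.inl _ => False
    | none, Sum.inr _ => True
    | some (Sum.inl r), Sum.inl s => s ≤ r
    | some (Sum.inl _), Sum.inr _ => True
    | some (Sum.inr _), Sum.inl _ => False
    | some (Sum.inr r), Sum.inr s => s ≤ r

section TableauSystem

variable {M : Type*} [AddCommMonoid M] (f : (ℕ →₀ ℕ) × (ℕ →₀ ℕ) → M) {a b : ℕ →₀ ℕ}

/-- After a box of `a`, an ascent can only be a box of `a` in a weakly higher row, so the run fills
a horizontal strip. -/
theorem tableauSystem_pathSum_inr (ha : Antitone a) (hb : Antitone b) (r k : ℕ) :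
    tableauSystem.pathSum f (List.replicate k (some true)) (some (Sum.inr r)) (a, b) =
      ∑ ν ∈ boundedStrips r a k, f (ν, b) := by
  classical
  induction k generalizing a r with
  | zero => simp [boundedStrips_zero r ha, PathSystem.pathSum]
  | succ k ih =>
    rw [List.replicate_succ, PathSystem.pathSum_cons_true, sum_boundedStrips_succ _ _ ha,
      Finset.sum_filter, Finset.sum_filter]
    simp only [ha, hb, and_self, if_true, Finset.sum_disjSum, Sum.elim_inr, if_false,
      Finset.sum_const_zero, zero_add, Nat.cast_le]
    refine Finset.sum_congr rfl fun s hs => ?_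
    rw [ih (mem_addable.mp hs)]
    congr

/-- From the start an ascent must add a box to `a`, just as the first letter of an ascending word
must be non-negative. -/
theorem tableauSystem_pathSum_start (ha : Antitone a) (hb : Antitone b) (k : ℕ) :
    tableauSystem.pathSum f (List.replicate k (some true)) none (a, b) =
      ∑ ν ∈ upperStrips a k, f (ν, b) := by
  classical
  rw [← boundedStrips_top]
  rcases k with _ | k
  · simp [boundedStrips_zero ⊤ ha, PathSystem.pathSum]
  · rw [List.replicate_succ, PathSystem.pathSum_cons_true, sum_boundedStrips_succ _ _ ha,
      Finset.sum_filter, Finset.sum_filter]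
    simp only [ha, hb, and_self, if_true, Finset.sum_disjSum, Sum.elim_inr, if_false,
      Finset.sum_const_zero, zero_add, le_top]
    refine Finset.sum_congr rfl fun s hs => ?_
    rw [tableauSystem_pathSum_inr f (mem_addable.mp hs) hb]

/-- The boxes of `b` play the role of the negative letters and come first in an ascending run.
Either the strip on `b` is nonempty and its first box is split off, or the whole run lies in `a`. -/
theorem sum_antidiagonal_boundedStrips (ha : Antitone a) (hb : Antitone b) (r : ℕ∞) (k : ℕ)
    [DecidablePred fun s : ℕ => (s : ℕ∞) ≤ r] :
    ∑ p ∈ Finset.HasAntidiagonal.antidiagonal (k + 1), ∑ ν' ∈ boundedStrips r b p.1,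
        ∑ ν ∈ upperStrips a p.2, f (ν, ν') =
      (∑ s ∈ (addable b).filter (fun s : ℕ => (s : ℕ∞) ≤ r),
        ∑ p ∈ Finset.HasAntidiagonal.antidiagonal k,
          ∑ ν' ∈ boundedStrips s (addBox b s) p.1, ∑ ν ∈ upperStrips a p.2, f (ν, ν')) +
      ∑ s ∈ addable a, ∑ ν ∈ boundedStrips (s : ℕ) (addBox a s) k, f (ν, b) := by
  rw [Finset.Nat.sum_antidiagonal_succ, add_comm, Finset.sum_comm
    (s := (addable b).filter (fun s : ℕ => (s : ℕ∞) ≤ r))]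
  refine congrArg₂ (· + ·) ?_ ?_
  · refine Finset.sum_congr rfl fun p _ => ?_
    simp only
    rw [sum_boundedStrips_succ _ _ hb]
    congr
  · simp only [boundedStrips_zero r hb, Finset.sum_singleton]
    rw [← boundedStrips_top, sum_boundedStrips_succ _ _ ha]
    simp

theorem tableauSystem_pathSum_inl (ha : Antitone a) (hb : Antitone b) (r k : ℕ) :
    tableauSystem.pathSum f (List.replicate k (some true)) (some (Sum.inl r)) (a, b) =
      ∑ p ∈ Finset.HasAntidiagonal.antidiagonal k, ∑ ν' ∈ boundedStrips r b p.1,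
        ∑ ν ∈ upperStrips a p.2, f (ν, ν') := by
  classical
  induction k generalizing b r with
  | zero =>
    simp [boundedStrips_zero r hb, PathSystem.pathSum, ← boundedStrips_top, boundedStrips_zero ⊤ ha]
  | succ k ih =>
    rw [List.replicate_succ, PathSystem.pathSum_cons_true, sum_antidiagonal_boundedStrips f ha hb,
      Finset.sum_filter, Finset.sum_filter]
    simp only [ha, hb, and_self, if_true, Finset.sum_disjSum, Sum.elim_inr, Sum.elim_inl,
      Nat.cast_le]
    congr 1
    · refine Finset.sum_congr rfl fun s hs => ?_
      rw [ih (mem_addable.mp hs)]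
      congr
    · refine Finset.sum_congr rfl fun s hs => ?_
      rw [tableauSystem_pathSum_inr f (mem_addable.mp hs) hb]

theorem tableauSystem_pathSum_cons_none (ha : Antitone a) (hb : Antitone b) (k : ℕ) :
    tableauSystem.pathSum f (none :: List.replicate k (some true)) none (a, b) =
      ∑ p ∈ Finset.HasAntidiagonal.antidiagonal (k + 1), ∑ ν' ∈ upperStrips b p.1,
        ∑ ν ∈ upperStrips a p.2, f (ν, ν') := by
  classical
  simp_rw [← boundedStrips_top b]
  rw [PathSystem.pathSum_cons_none, sum_antidiagonal_boundedStrips f ha hb]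
  simp only [ha, hb, and_self, if_true, Finset.sum_disjSum, Sum.elim_inr, Sum.elim_inl,
    le_top, Finset.filter_true]
  congr 1
  · refine Finset.sum_congr rfl fun s hs => ?_
    rw [tableauSystem_pathSum_inl f ha (mem_addable.mp hs)]
  · refine Finset.sum_congr rfl fun s hs => ?_
    rw [tableauSystem_pathSum_inr f (mem_addable.mp hs) hb]

end TableauSystem

/-! ### Words and bitableaux -/

section Compare

variable {R : Type} [CommRing R] (x : ℕ → R) (m : ℕ)

/-- The Schur polynomial of a pair of partitions, in the variables `x 0, …, x m` for the first one
and `x 1, …, x m` for the second one. -/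
noncomputable def bischur (z : (ℕ →₀ ℕ) × (ℕ →₀ ℕ)) : R :=
  schur x (m + 1) z.1 * schur (fun i => x (i + 1)) m z.2

theorem schur_eq_zero (x : ℕ → R) (m : ℕ) {a : ℕ →₀ ℕ} (ha : ¬ Antitone a) : schur x m a = 0 := by
  cases m with
  | zero =>
    have : a ≠ 0 := by rintro rfl; exact ha fun _ _ _ => le_rfl
    simp [schur, this]
  | succ m =>
    rw [schur]
    refine Finset.sum_eq_zero fun κ hκ => ?_
    exact absurd (mem_lowerStrips.mp hκ).antitone_right ha

/-- The negative integers. -/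
def negSuccEmbedding : ℕ ↪ ℤ := ⟨fun i => -((i : ℤ) + 1), fun i j h => by simpa using h⟩

theorem negSuccEmbedding_apply (i : ℕ) : negSuccEmbedding i = -((i : ℤ) + 1) := rfl

/-- The negative letters carry the variables x_1, …, x_m and the others x_0, …, x_m, which are the
two alphabets of `bischur`. -/
theorem complete_natAbs (k : ℕ) :
    complete (fun i : ℤ => x i.natAbs) (Finset.Icc (-(m : ℤ)) m) k =
      ∑ p ∈ Finset.HasAntidiagonal.antidiagonal k,
        complete (fun i => x (i + 1)) (Finset.range m) p.1 *
          complete x (Finset.range (m + 1)) p.2 := by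
  have h : Finset.Icc (-(m : ℤ)) m =
      (Finset.range m).map negSuccEmbedding ∪
        (Finset.range (m + 1)).map Nat.castEmbedding := by
    ext i
    simp only [Finset.mem_Icc, Finset.mem_union, Finset.mem_map, Finset.mem_range,
      negSuccEmbedding_apply, Nat.castEmbedding_apply]
    constructor
    · intro hi
      rcases lt_or_ge i 0 with h | h
      · exact Or.inl ⟨(-i - 1).toNat, by omega, by omega⟩
      · exact Or.inr ⟨i.toNat, by omega, by omega⟩
    · rintro (⟨j, hj, rfl⟩ | ⟨j, hj, rfl⟩) <;> omega
  rw [h, complete_union]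
  · refine Finset.sum_congr rfl fun p _ => ?_
    rw [complete_map, complete_map]
    congr 1
  · rw [Finset.disjoint_left]
    simp only [Finset.mem_map, Finset.mem_range, negSuccEmbedding_apply,
      Nat.castEmbedding_apply]
    rintro i ⟨j, hj, rfl⟩ ⟨j', hj', h⟩
    omega

theorem complete_natAbs_nonneg (k : ℕ) :
    complete (fun i : ℤ => x i.natAbs) ((Finset.Icc (-(m : ℤ)) m).filter (0 ≤ ·)) k =
      complete x (Finset.range (m + 1)) k := by
  have h : (Finset.Icc (-(m : ℤ)) m).filter (0 ≤ ·) =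
      (Finset.range (m + 1)).map Nat.castEmbedding := by
    ext i
    simp only [Finset.mem_Icc, Finset.mem_filter, Finset.mem_map, Finset.mem_range,
      Nat.castEmbedding_apply]
    constructor
    · intro hi
      exact ⟨i.toNat, by omega, by omega⟩
    · rintro ⟨j, hj, rfl⟩
      omega
  rw [h, complete_map]
  simp

theorem bischur_zero : bischur x m (0, 0) = 1 := by
  have : ∀ (y : ℕ → R) (k : ℕ), schur y k 0 = 1 := by
    intro y k
    induction k with
    | zero => simp [schur]
    | succ k ih =>
      have h : lowerStrips (0 : ℕ →₀ ℕ) = {0} := by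
        ext κ
        rw [mem_lowerStrips, Finset.mem_singleton]
        constructor
        · intro h
          exact le_antisymm h.le (by simp)
        · rintro rfl
          exact fun i => by simp
      rw [schur, h, Finset.sum_singleton, ih]
      simp
  simp [bischur, this]

/-- The generating function of the words in `{-m, …, m}` with prescribed descents is the sum of the
Schur polynomials of the standard bitableaux with these descents. -/
theorem pathSum_tableauSystem_eq (ds : List (Option Bool)) :
    tableauSystem.pathSum (bischur x m) ds none (0, 0) =
      (wordSystem (fun i : ℤ => x i.natAbs) (Finset.Icc (-(m : ℤ)) m)).pathSum (fun w : R => w)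
        ds none (1 : R) := by
  refine PathSystem.pathSum_eq
    (S₁ := tableauSystem) (S₂ := wordSystem (fun i : ℤ => x i.natAbs) (Finset.Icc (-(m : ℤ)) m)) (f₁ := bischur x m) (f₂ := fun w : R => w)
    (fun k => complete (fun i : ℤ => x i.natAbs) (Finset.Icc (-(m : ℤ)) m) (k + 1))
    ?_ (fun k z => wordSystem_pathSum_cons_none _ _ k z) _ _ ?_ ds
  · rintro k ⟨a, b⟩
    by_cases hab : Antitone a ∧ Antitone b
    · rw [tableauSystem_pathSum_cons_none _ hab.1 hab.2, complete_natAbs, Finset.sum_mul]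
      refine Finset.sum_congr rfl fun p _ => ?_
      simp only [bischur]
      simp_rw [← Finset.sum_mul, ← Finset.mul_sum]
      rw [sum_upperStrips_schur, sum_upperStrips_schur]
      ring
    -- The identity is required at every state. No step leaves a pair which is not made of
    -- partitions, and `bischur` vanishes there too.
    · rw [PathSystem.pathSum_cons_none]
      simp only [hab, if_false, Finset.sum_empty]
      simp only [bischur]
      rcases not_and_or.mp hab with h | h
      · rw [schur_eq_zero x _ h]; ring
      · rw [schur_eq_zero _ _ h]; ring
  · intro k
    have h0 : Antitone (0 : ℕ →₀ ℕ) := fun _ _ _ => le_rfl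
    rw [tableauSystem_pathSum_start _ h0 h0]
    refine Eq.trans ?_ (wordSystem_pathSum_replicate _ _ k none (1 : R)).symm
    simp only [Option.getD_none, complete_natAbs_nonneg]
    simp only [bischur]
    rw [← Finset.sum_mul, sum_upperStrips_schur]
    have := bischur_zero x m
    simp only [bischur] at this
    rw [mul_assoc, this]

end Compare

/-! ### Rank functions of Young diagrams -/

/-- The functions which count the beads of a Maya diagram of charge zero to the right of a given
point. The Young diagram corresponding to `F` consists of the cells `(i, j)` with
`i < F (j - i)`. -/
structure IsRank (F : ℤ → ℤ) : Prop where
  anti : ∀ c, F (c + 1) ≤ F c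
  step : ∀ c, F c ≤ F (c + 1) + 1
  bound : ∃ C : ℤ, 0 ≤ C ∧ ∀ c, C ≤ c → F c = 0 ∧ F (-c) = c

namespace IsRank

variable {F : ℤ → ℤ} (hF : IsRank F)
include hF

theorem antitone {c d : ℤ} (h : c ≤ d) : F d ≤ F c := by
  obtain ⟨n, rfl⟩ := Int.le.dest h
  clear h
  induction n with
  | zero => simp
  | succ n ih =>
    have := hF.anti (c + n)
    push_cast
    rw [← add_assoc]
    omega

theorem le_add {c d : ℤ} (h : c ≤ d) : F c ≤ F d + (d - c) := by
  obtain ⟨n, rfl⟩ := Int.le.dest h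
  clear h
  induction n with
  | zero => simp
  | succ n ih =>
    have := hF.step (c + n)
    push_cast at ih ⊢
    rw [← add_assoc]
    omega

theorem nonneg (c : ℤ) : 0 ≤ F c := by
  obtain ⟨C, hC, h⟩ := hF.bound
  have h1 := hF.antitone (le_max_left c C)
  rw [(h _ (le_max_right c C)).1] at h1
  exact h1

theorem neg_le (c : ℤ) : -c ≤ F c := by
  obtain ⟨C, hC, h⟩ := hF.bound
  have h1 := hF.le_add (show -(max (-c) C) ≤ c by have := le_max_left (-c) C; omega)
  rw [(h _ (le_max_right (-c) C)).2] at h1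
  omega

end IsRank

/-- Rank functions are compared by testing their values against row indices. -/
theorem le_of_forall_natCast_lt {x y : ℤ} (hy : 0 ≤ y) (h : ∀ i : ℕ, (i : ℤ) < x → (i : ℤ) < y) :
    x ≤ y := by
  by_contra hlt
  have := h y.toNat (by omega)
  omega

open Classical in
/-- The Young diagram with a given rank function. -/
noncomputable def ofRank (F : ℤ → ℤ) (hF : IsRank F) : YoungDiagram where
  cells := (Finset.range (2 * hF.bound.choose.toNat) ×ˢ
    Finset.range (2 * hF.bound.choose.toNat)).filter fun p => (p.1 : ℤ) < F (p.2 - p.1)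
  isLowerSet := by
    rintro ⟨i, j⟩ ⟨i', j'⟩ h hm
    obtain ⟨hi, hj⟩ := Prod.mk_le_mk.mp h
    simp only [Finset.coe_filter, Finset.mem_product, Finset.mem_range, Set.mem_ofPred_eq] at hm ⊢
    refine ⟨by omega, ?_⟩
    have h1 := hF.le_add (show (j : ℤ) - i ≤ j - i' by omega)
    have h2 := hF.antitone (show (j' : ℤ) - i' ≤ j - i' by omega)
    omega

theorem mem_ofRank {F : ℤ → ℤ} (hF : IsRank F) {i j : ℕ} :
    (i, j) ∈ ofRank F hF ↔ (i : ℤ) < F (j - i) := by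
  rw [← YoungDiagram.mem_cells]
  simp only [ofRank, Finset.mem_filter, Finset.mem_product, Finset.mem_range, and_iff_right_iff_imp]
  obtain ⟨hC, h⟩ := hF.bound.choose_spec
  set C := hF.bound.choose
  -- A cell satisfies |j - i| < C, and i < F (-C) = C by monotonicity, so the box of side 2C
  -- contains the whole diagram.
  intro hi
  have h1 : (j : ℤ) - i < C := by
    by_contra hlt
    have := (h _ (not_lt.mp hlt)).1
    omega
  have h2 : (i : ℤ) - j < C := by
    by_contra hlt
    have := (h _ (not_lt.mp hlt)).2
    rw [neg_sub] at this
    omega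
  have h3 := hF.antitone (show -C ≤ (j : ℤ) - i by omega)
  rw [(h C le_rfl).2] at h3
  omega

theorem ofRank_injective {F G : ℤ → ℤ} (hF : IsRank F) (hG : IsRank G)
    (h : ofRank F hF = ofRank G hG) : F = G := by
  have key : ∀ {F G : ℤ → ℤ} (hF : IsRank F) (hG : IsRank G), ofRank F hF = ofRank G hG →
      ∀ c, F c ≤ G c := by
    intro F G hF hG h c
    refine le_of_forall_natCast_lt (hG.nonneg c) fun i hi => ?_
    -- If i + c < 0, row i has no cell on the diagonal c, and the bound `-c ≤ G c` replaces the
    -- membership test.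
    rcases lt_or_ge ((i : ℤ) + c) 0 with hc | hc
    · have := hG.neg_le c
      omega
    · have e : c = (((i : ℤ) + c).toNat : ℕ) - (i : ℤ) := by omega
      rw [e] at hi ⊢
      rwa [← mem_ofRank hG, ← h, mem_ofRank hF]
  funext c
  exact le_antisymm (key hF hG h c) (key hG hF h.symm c)

/-! ### Rank functions of partitions -/

theorem exists_le_add (a : ℕ →₀ ℕ) (c : ℤ) : ∃ i : ℕ, (a i : ℤ) ≤ i + c := by
  obtain ⟨i, hi⟩ := Infinite.exists_notMem_finset (a.support ∪ Finset.range (-c).toNat)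
  simp only [Finset.mem_union, Finsupp.mem_support_iff, Finset.mem_range, not_or, not_not] at hi
  exact ⟨i, by omega⟩

/-- The rank function of a partition. -/
noncomputable def seqRank (a : ℕ →₀ ℕ) (c : ℤ) : ℤ := Nat.find (exists_le_add a c)

section SeqRank

variable {a b : ℕ →₀ ℕ}

/-- On the diagonal `c`, row i meets column i + c, so this is membership of a cell, with cells left
of the diagram counted as filled. As `a` decreases while i + c increases, testing at `i` covers all
smaller rows. -/
theorem natCast_lt_seqRank (ha : Antitone a) {i : ℕ} {c : ℤ} :
    (i : ℤ) < seqRank a c ↔ i + c < a i := by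
  rw [seqRank, Nat.cast_lt, Nat.lt_find_iff]
  constructor
  · intro h
    simpa using h i le_rfl
  · intro h m hm
    have := ha hm
    omega

theorem seqRank_nonneg (a : ℕ →₀ ℕ) (c : ℤ) : 0 ≤ seqRank a c := Int.natCast_nonneg _

theorem isRank_seqRank (ha : Antitone a) : IsRank (seqRank a) where
  anti c := le_of_forall_natCast_lt (seqRank_nonneg _ _) fun i hi => by
    rw [natCast_lt_seqRank ha] at hi ⊢
    omega
  step c := le_of_forall_natCast_lt (by have := seqRank_nonneg a (c + 1); omega) fun i hi => by
    rcases i with _ | i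
    · have := seqRank_nonneg a (c + 1)
      push_cast
      omega
    · have h : (i : ℤ) < seqRank a (c + 1) := by
        rw [natCast_lt_seqRank ha] at hi ⊢
        have := ha (Nat.le_succ i)
        push_cast at hi
        simp only [Nat.succ_eq_add_one] at this
        omega
      push_cast
      omega
  bound := by
    obtain ⟨N, hN⟩ := a.support.bddAbove
    refine ⟨a 0 + N + 1, by omega, fun c hc => ⟨?_, ?_⟩⟩
    · refine le_antisymm (le_of_forall_natCast_lt le_rfl fun i hi => ?_) (seqRank_nonneg _ _)
      rw [natCast_lt_seqRank ha] at hi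
      have := ha (Nat.zero_le i)
      omega
    · refine le_antisymm (le_of_forall_natCast_lt (by omega) fun i hi => ?_)
        (le_of_forall_natCast_lt (seqRank_nonneg _ _) fun i hi => ?_)
      · rw [natCast_lt_seqRank ha] at hi
        by_contra hlt
        have h0 : a i ≠ 0 := by omega
        have : i ≤ N := hN (by simpa using h0)
        omega
      · rw [natCast_lt_seqRank ha]
        omega

theorem le_iff_seqRank_le (ha : Antitone a) (hb : Antitone b) :
    (∀ i, a i ≤ b i) ↔ ∀ c, seqRank a c ≤ seqRank b c := by
  constructor
  · intro h c
    refine le_of_forall_natCast_lt (seqRank_nonneg _ _) fun i hi => ?_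
    rw [natCast_lt_seqRank ha] at hi
    rw [natCast_lt_seqRank hb]
    have := h i
    omega
  · intro h i
    by_contra hlt
    have h1 : (i : ℤ) < seqRank a ((b i : ℤ) - i) := by
      rw [natCast_lt_seqRank ha]; omega
    have h2 := h1.trans_le (h _)
    rw [natCast_lt_seqRank hb] at h2
    omega

theorem seqRank_injective (ha : Antitone a) (hb : Antitone b) (h : seqRank a = seqRank b) :
    a = b := by
  ext i
  exact le_antisymm ((le_iff_seqRank_le ha hb).mpr (fun c => by rw [h]) i)
    ((le_iff_seqRank_le hb ha).mpr (fun c => by rw [h]) i)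

/-- A cell (i + 1, j) of `b` must have the cell (i, j) in `a`. Moving up one row passes to the next
diagonal, whence the argument `c + 1` and the extra 1. -/
theorem interlace_iff_seqRank (ha : Antitone a) (hb : Antitone b) : Interlace a b ↔
    ∀ c, seqRank a c ≤ seqRank b c ∧ seqRank b c ≤ seqRank a (c + 1) + 1 := by
  have h2 : (∀ i, b (i + 1) ≤ a i) ↔ ∀ c, seqRank b c ≤ seqRank a (c + 1) + 1 := by
    constructor
    · intro h c
      have h0 := seqRank_nonneg a (c + 1)
      refine le_of_forall_natCast_lt (by omega) fun i hi => ?_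
      rcases i with _ | i
      · push_cast; omega
      · have : (i : ℤ) < seqRank a (c + 1) := by
          rw [natCast_lt_seqRank hb] at hi
          rw [natCast_lt_seqRank ha]
          have := h i
          push_cast at hi
          omega
        push_cast; omega
    · intro h i
      by_contra hlt
      have h1 : ((i + 1 : ℕ) : ℤ) < seqRank b ((a i : ℤ) - (i + 1)) := by
        rw [natCast_lt_seqRank hb]; push_cast; omega
      have h2 : (i : ℤ) < seqRank a ((a i : ℤ) - (i + 1) + 1) := by
        have := h ((a i : ℤ) - (i + 1))
        push_cast at h1
        omega
      rw [natCast_lt_seqRank ha] at h2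
      omega
  rw [forall_and, ← le_iff_seqRank_le ha hb, ← h2, ← forall_and]
  rfl

end SeqRank

/-! ### The partition of a Young diagram -/

/-- The sequence of row lengths of a Young diagram. -/
noncomputable def rowSeq (lam : YoungDiagram) : ℕ →₀ ℕ :=
  Finsupp.onFinset (Finset.range (lam.colLen 0)) lam.rowLen fun i hi => by
    rw [Finset.mem_range, ← YoungDiagram.mem_iff_lt_colLen, YoungDiagram.mem_iff_lt_rowLen]
    exact Nat.pos_of_ne_zero hi

@[simp] theorem rowSeq_apply (lam : YoungDiagram) (i : ℕ) : rowSeq lam i = lam.rowLen i := rfl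

theorem antitone_rowSeq (lam : YoungDiagram) : Antitone (rowSeq lam) :=
  fun _ _ h => lam.rowLen_anti _ _ h

theorem mem_iff_lt_seqRank (lam : YoungDiagram) (i j : ℕ) :
    (i, j) ∈ lam ↔ (i : ℤ) < seqRank (rowSeq lam) (j - i) := by
  rw [natCast_lt_seqRank (antitone_rowSeq lam), YoungDiagram.mem_iff_lt_rowLen, rowSeq_apply]
  omega

theorem exists_ofRank_eq (lam : YoungDiagram) : ∃ (F : ℤ → ℤ) (hF : IsRank F), lam = ofRank F hF := by
  refine ⟨_, isRank_seqRank (antitone_rowSeq lam), ?_⟩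
  ext ⟨i, j⟩
  rw [YoungDiagram.mem_cells, YoungDiagram.mem_cells, mem_iff_lt_seqRank, mem_ofRank]

theorem IsRank.exists_seqRank_eq {F : ℤ → ℤ} (hF : IsRank F) :
    ∃ a : ℕ →₀ ℕ, Antitone a ∧ seqRank a = F := by
  have h := isRank_seqRank (antitone_rowSeq (ofRank F hF))
  refine ⟨rowSeq (ofRank F hF), antitone_rowSeq _, ofRank_injective h hF ?_⟩
  ext ⟨i, j⟩
  rw [YoungDiagram.mem_cells, YoungDiagram.mem_cells, mem_ofRank, ← mem_iff_lt_seqRank]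

/-! ### The Young diagram with a given 2-quotient -/

/-- The rank function of the Young diagram with empty 2-core and 2-quotient `(a, b)`. -/
noncomputable def dominoRank (a b : ℕ →₀ ℕ) (c : ℤ) : ℤ :=
  seqRank a (c / 2) + seqRank b ((c + 1) / 2)

section DominoRank

variable {a b : ℕ →₀ ℕ}

theorem dominoRank_two_mul (a b : ℕ →₀ ℕ) (k : ℤ) :
    dominoRank a b (2 * k) = seqRank a k + seqRank b k := by
  rw [dominoRank, show 2 * k / 2 = k by omega, show (2 * k + 1) / 2 = k by omega]

theorem dominoRank_two_mul_add_one (a b : ℕ →₀ ℕ) (k : ℤ) :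
    dominoRank a b (2 * k + 1) = seqRank a k + seqRank b (k + 1) := by
  rw [dominoRank, show (2 * k + 1) / 2 = k by omega, show (2 * k + 1 + 1) / 2 = k + 1 by omega]

/-- The two Maya diagrams are interleaved: from c to c + 1 exactly one of the two ranks advances,
that of `b` for even c and that of `a` for odd c. -/
theorem isRank_dominoRank (ha : Antitone a) (hb : Antitone b) : IsRank (dominoRank a b) := by
  have hA := isRank_seqRank ha
  have hB := isRank_seqRank hb
  have key : ∀ c, dominoRank a b (c + 1) ≤ dominoRank a b c ∧
      dominoRank a b c ≤ dominoRank a b (c + 1) + 1 := by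
    intro c
    rcases Int.even_or_odd' c with ⟨k, rfl | rfl⟩
    · rw [dominoRank_two_mul, dominoRank_two_mul_add_one]
      have := hB.anti k; have := hB.step k
      omega
    · rw [show 2 * k + 1 + 1 = 2 * (k + 1) by ring, dominoRank_two_mul, dominoRank_two_mul_add_one]
      have := hA.anti k; have := hA.step k
      omega
  refine ⟨fun c => (key c).1, fun c => (key c).2, ?_⟩
  obtain ⟨C, hC, h⟩ := hA.bound
  obtain ⟨D, hD, h'⟩ := hB.bound
  refine ⟨2 * (C + D) + 2, by omega, fun c hc => ?_⟩
  have h1 := (h (c / 2) (by omega)).1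
  have h2 := (h' ((c + 1) / 2) (by omega)).1
  have h3 := (h (-(-c / 2)) (by omega)).2
  have h4 := (h' (-((-c + 1) / 2)) (by omega)).2
  rw [neg_neg] at h3 h4
  constructor
  · rw [dominoRank, h1, h2]; rfl
  · rw [dominoRank, h3, h4]; omega

/-- All ranks vanish far to the right. Going leftwards, the value at 2k + 1 yields the rank of `a`
at k from that of `b` at k + 1, and the value at 2k then yields the rank of `b` at k. -/
theorem dominoRank_injective {a' b' : ℕ →₀ ℕ} (ha : Antitone a) (hb : Antitone b)
    (ha' : Antitone a') (hb' : Antitone b') (h : dominoRank a b = dominoRank a' b') :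
    a = a' ∧ b = b' := by
  obtain ⟨A, -, hA⟩ := (isRank_seqRank ha).bound
  obtain ⟨A', -, hA'⟩ := (isRank_seqRank ha').bound
  obtain ⟨B, -, hB⟩ := (isRank_seqRank hb).bound
  obtain ⟨B', -, hB'⟩ := (isRank_seqRank hb').bound
  set N := |A| + |A'| + |B| + |B'| with hN
  have := abs_nonneg A; have := abs_nonneg A'; have := abs_nonneg B; have := abs_nonneg B'
  have := le_abs_self A; have := le_abs_self A'; have := le_abs_self B; have := le_abs_self B'
  have key : ∀ n : ℕ, ∀ k, N - n ≤ k → seqRank a k = seqRank a' k ∧ seqRank b k = seqRank b' k := by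
    intro n
    induction n with
    | zero =>
      intro k hk
      rw [(hA k (by omega)).1, (hA' k (by omega)).1, (hB k (by omega)).1, (hB' k (by omega)).1]
      exact ⟨rfl, rfl⟩
    | succ n ih =>
      intro k hk
      have h1 := (ih (k + 1) (by push_cast at hk; omega)).2
      have h2 := congrFun h (2 * k)
      have h3 := congrFun h (2 * k + 1)
      rw [dominoRank_two_mul, dominoRank_two_mul] at h2
      rw [dominoRank_two_mul_add_one, dominoRank_two_mul_add_one] at h3
      omega
  have key' : ∀ k, seqRank a k = seqRank a' k ∧ seqRank b k = seqRank b' k :=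
    fun k => key (N - k).toNat k (by omega)
  exact ⟨seqRank_injective ha ha' (funext fun k => (key' k).1),
    seqRank_injective hb hb' (funext fun k => (key' k).2)⟩

open Classical in
/-- The Young diagram with empty 2-core and 2-quotient `(a, b)`. -/
noncomputable def dominoShape (z : (ℕ →₀ ℕ) × (ℕ →₀ ℕ)) : YoungDiagram :=
  if h : Antitone z.1 ∧ Antitone z.2 then ofRank _ (isRank_dominoRank h.1 h.2) else ⊥

theorem dominoShape_eq (ha : Antitone a) (hb : Antitone b) :
    dominoShape (a, b) = ofRank _ (isRank_dominoRank ha hb) :=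
  dif_pos (show Antitone (a, b).1 ∧ Antitone (a, b).2 from ⟨ha, hb⟩)

theorem dominoShape_injective {a' b' : ℕ →₀ ℕ} (ha : Antitone a) (hb : Antitone b)
    (ha' : Antitone a') (hb' : Antitone b') (h : dominoShape (a, b) = dominoShape (a', b')) :
    a = a' ∧ b = b' := by
  rw [dominoShape_eq ha hb, dominoShape_eq ha' hb'] at h
  exact dominoRank_injective ha hb ha' hb' (ofRank_injective _ _ h)

theorem seqRank_zero_eq (c : ℤ) : seqRank 0 c = max 0 (-c) := by
  have h : Antitone (0 : ℕ →₀ ℕ) := fun _ _ _ => le_rfl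
  refine le_antisymm (le_of_forall_natCast_lt (le_max_left _ _) fun i hi => ?_)
    (le_of_forall_natCast_lt (seqRank_nonneg _ _) fun i hi => ?_)
  · rw [natCast_lt_seqRank h] at hi
    simp only [Finsupp.coe_zero, Pi.zero_apply, Nat.cast_zero] at hi
    omega
  · rw [natCast_lt_seqRank h]
    simp only [Finsupp.coe_zero, Pi.zero_apply, Nat.cast_zero]
    omega

theorem dominoShape_zero : dominoShape (0, 0) = ⊥ := by
  have h : Antitone (0 : ℕ →₀ ℕ) := fun _ _ _ => le_rfl
  rw [dominoShape_eq h h]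
  ext ⟨i, j⟩
  rw [YoungDiagram.mem_cells, mem_ofRank, dominoRank, seqRank_zero_eq, seqRank_zero_eq]
  simp only [YoungDiagram.cells_bot, Finset.notMem_empty, iff_false, not_lt]
  omega

end DominoRank

/-! ### Domino strips -/

namespace Domino

/-- The row of the lower left cell of a domino. -/
def footRow (d : Domino) : ℕ := if d.2 then d.1.1 + 1 else d.1.1

/-- The column of the upper right cell of a domino. -/
def headCol (d : Domino) : ℕ := if d.2 then d.1.2 else d.1.2 + 1

/-- The content of the lower left cell of a domino. -/
def content (d : Domino) : ℤ := (d.1.2 : ℤ) - d.footRow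

/-- In both orientations a domino has an upper right cell, its head, and a lower left cell, its
foot, of content one less. This makes a uniform treatment of the two orientations possible. -/
theorem mem_cells_iff {d : Domino} {i j : ℕ} :
    (i, j) ∈ d.cells ↔ (i = d.1.1 ∧ j = d.headCol) ∨ (i = d.footRow ∧ j = d.1.2) := by
  obtain ⟨⟨x, y⟩, v⟩ := d
  cases v <;> simp [cells, footRow, headCol, or_comm]

theorem head_mem (d : Domino) : (d.1.1, d.headCol) ∈ d.cells := mem_cells_iff.mpr (Or.inl ⟨rfl, rfl⟩)

theorem foot_mem (d : Domino) : (d.footRow, d.1.2) ∈ d.cells := mem_cells_iff.mpr (Or.inr ⟨rfl, rfl⟩)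

theorem headCol_sub (d : Domino) : (d.headCol : ℤ) - d.1.1 = d.content + 1 := by
  obtain ⟨⟨x, y⟩, v⟩ := d
  cases v <;> simp [content, footRow, headCol] <;> ring

theorem footRow_eq_or (d : Domino) : (d.footRow = d.1.1 ∧ d.headCol = d.1.2 + 1 ∧ d.2 = false) ∨
    (d.footRow = d.1.1 + 1 ∧ d.headCol = d.1.2 ∧ d.2 = true) := by
  obtain ⟨⟨x, y⟩, v⟩ := d
  cases v <;> simp [footRow, headCol]

theorem card_cells (d : Domino) : d.cells.card = 2 := by
  obtain ⟨⟨x, y⟩, v⟩ := d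
  cases v <;> simp [cells]

end Domino

/-- `S` is a tiling of `lam / lam'` by dominoes, no two of which meet the same column. -/
structure IsStrip (lam' lam : YoungDiagram) (S : Finset Domino) : Prop where
  le : lam' ≤ lam
  inside : ∀ d ∈ S, ∀ c ∈ d.cells, c ∈ lam ∧ c ∉ lam'
  cover : ∀ c ∈ lam, c ∉ lam' → ∃ d ∈ S, c ∈ d.cells
  column : ∀ d ∈ S, ∀ e ∈ S, ∀ i i' j : ℕ, (i, j) ∈ d.cells → (i', j) ∈ e.cells → d = e

/-- The condition on rank functions which characterizes the existence of a strip: `t c` is the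
number of dominoes of content `c`. -/
structure RankStrip (F' F t : ℤ → ℤ) : Prop where
  zero_or_one : ∀ c, t c = 0 ∨ t c = 1
  eq : ∀ c, F c = F' c + t (c - 1) + t c
  flat : ∀ c, t c = 1 → F' (c + 1) = F' (c + 2)

/-- The domino of content `c` in a strip. -/
def stripDomino (F' t : ℤ → ℤ) (c : ℤ) : Domino :=
  if F' c + t (c - 1) = F' (c + 1) then (((F' (c + 1)).toNat, (F' (c + 1) + c).toNat), false)
  else (((F' (c + 1)).toNat, (F' (c + 1) + c + 1).toNat), true)

namespace RankStrip

variable {F' F t t' : ℤ → ℤ}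

theorem exists_bound (h : RankStrip F' F t) (hF' : IsRank F') (hF : IsRank F) :
    ∃ C : ℤ, ∀ c, t c ≠ 0 → -C < c ∧ c < C := by
  obtain ⟨C', hC', h1⟩ := hF'.bound
  obtain ⟨C, hC, h2⟩ := hF.bound
  refine ⟨C + C', fun c hc => ?_⟩
  have h3 := h.zero_or_one c
  have h4 := h.zero_or_one (c - 1)
  have h5 := h.eq c
  constructor
  · by_contra hlt
    have h6 := (h1 (-c) (by omega)).2
    have h7 := (h2 (-c) (by omega)).2
    rw [neg_neg] at h6 h7
    omega
  · by_contra hlt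
    have h6 := (h1 c (by omega)).1
    have h7 := (h2 c (by omega)).1
    omega

/-- The recurrence t c = F c - F' c - t (c - 1) starts from 0 far to the left. -/
theorem unique (h : RankStrip F' F t) (h' : RankStrip F' F t') (hF' : IsRank F') (hF : IsRank F) :
    t = t' := by
  obtain ⟨C, hC⟩ := h.exists_bound hF' hF
  obtain ⟨C', hC'⟩ := h'.exists_bound hF' hF
  have key : ∀ n : ℕ, ∀ c, c ≤ -(|C| + |C'|) + n → t c = t' c := by
    intro n
    induction n with
    | zero =>
      intro c hc
      have := neg_abs_le C; have := neg_abs_le C'; have := le_abs_self C; have := le_abs_self C'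
      have h1 : t c = 0 := by
        by_contra h0
        have := hC c h0
        push_cast at hc; omega
      have h2 : t' c = 0 := by
        by_contra h0
        have := hC' c h0
        push_cast at hc; omega
      rw [h1, h2]
    | succ n ih =>
      intro c hc
      have h1 := ih (c - 1) (by push_cast at hc; omega)
      have h2 := h.eq c
      have h3 := h'.eq c
      omega
  funext c
  exact key (c + (|C| + |C'|)).toNat c (by omega)

/-- The foot of `stripDomino` is in the row of its head or in the next row, so the two prescribed
cells do form a domino. If `t (c - 1) = 1`, flatness at c - 1 makes the domino vertical. -/
theorem foot_eq_or (h : RankStrip F' F t) (hF' : IsRank F') (c : ℤ) :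
    F' c + t (c - 1) = F' (c + 1) ∨ F' c + t (c - 1) = F' (c + 1) + 1 := by
  have h1 := hF'.anti c
  have h2 := hF'.step c
  rcases h.zero_or_one (c - 1) with h3 | h3
  · omega
  · have h4 := h.flat _ h3
    rw [show c - 1 + 1 = c by ring, show c - 1 + 2 = c + 1 by ring] at h4
    omega

variable (h : RankStrip F' F t) (hF' : IsRank F')
include h hF'

theorem stripDomino_spec (c : ℤ) :
    ((stripDomino F' t c).1.1 : ℤ) = F' (c + 1) ∧
    ((stripDomino F' t c).headCol : ℤ) = F' (c + 1) + c + 1 ∧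
    ((stripDomino F' t c).footRow : ℤ) = F' c + t (c - 1) ∧
    ((stripDomino F' t c).1.2 : ℤ) = F' c + t (c - 1) + c := by
  have h1 := hF'.nonneg (c + 1)
  have h2 := hF'.neg_le (c + 1)
  have h3 := hF'.neg_le c
  have h4 := h.zero_or_one (c - 1)
  unfold stripDomino
  rcases h.foot_eq_or hF' c with h5 | h5
  · rw [if_pos h5]
    simp only [Domino.headCol, Domino.footRow, Bool.false_eq_true, if_false]
    push_cast
    omega
  · rw [if_neg (by omega)]
    simp only [Domino.headCol, Domino.footRow, if_true]
    push_cast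
    omega

theorem mem_stripDomino {c : ℤ} {i j : ℕ} :
    (i, j) ∈ (stripDomino F' t c).cells ↔
      ((i : ℤ) = F' (c + 1) ∧ (j : ℤ) - i = c + 1) ∨ ((i : ℤ) = F' c + t (c - 1) ∧ (j : ℤ) - i = c) := by
  obtain ⟨h1, h2, h3, h4⟩ := h.stripDomino_spec hF' c
  rw [Domino.mem_cells_iff]
  omega

/-- The last column of the domino of content c is F' (c + 1) + c + 1, the first one of the domino of
content e is F' e + t (e - 1) + e. Since F' x + x is weakly increasing, flatness at c separates them
when e ≥ c + 2; when e = c + 1, the term t c = 1 does. -/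
theorem column_lt {c e : ℤ} (hc : t c = 1) (he : t e = 1) (hce : c < e) {i i' j : ℕ}
    (hi : (i, j) ∈ (stripDomino F' t c).cells) (hi' : (i', j) ∈ (stripDomino F' t e).cells) :
    False := by
  rw [h.mem_stripDomino hF'] at hi
  rw [h.mem_stripDomino hF'] at hi'
  have h1 := h.flat c hc
  have h2 := h.foot_eq_or hF' c
  have h3 := h.foot_eq_or hF' e
  have h4 := hF'.le_add (show c + 2 ≤ e + 1 by omega)
  have h5 := h.zero_or_one (e - 1)
  have h6 := hF'.anti e
  by_cases hec : e = c + 1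
  · subst hec
    rw [show c + 1 - 1 = c by ring] at *
    rw [show c + 1 + 1 = c + 2 by ring] at *
    omega
  · have h7 := hF'.le_add (show c + 2 ≤ e by omega)
    omega

theorem exists_isStrip (hF : IsRank F) : ∃ S : Finset Domino, IsStrip (ofRank F' hF') (ofRank F hF) S ∧
    ∀ d, d ∈ S ↔ ∃ c, t c = 1 ∧ d = stripDomino F' t c := by
  classical
  obtain ⟨C, hC⟩ := h.exists_bound hF' hF
  have hS : ∀ d, d ∈ ((Finset.Icc (-C) C).filter (fun c => t c = 1)).image (stripDomino F' t) ↔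
      ∃ c, t c = 1 ∧ d = stripDomino F' t c := by
    intro d
    simp only [Finset.mem_image, Finset.mem_filter, Finset.mem_Icc]
    constructor
    · rintro ⟨c, ⟨-, hc⟩, rfl⟩
      exact ⟨c, hc, rfl⟩
    · rintro ⟨c, hc, rfl⟩
      have := hC c (by omega)
      exact ⟨c, ⟨by omega, hc⟩, rfl⟩
  refine ⟨_, ⟨?_, ?_, ?_, ?_⟩, hS⟩
  · rintro ⟨i, j⟩ hij
    rw [mem_ofRank] at hij ⊢
    have h1 := h.eq (j - i)
    have h2 := h.zero_or_one (j - i)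
    have h3 := h.zero_or_one ((j : ℤ) - i - 1)
    omega
  · rintro d hd ⟨i, j⟩ hij
    obtain ⟨c, hc, rfl⟩ := (hS d).mp hd
    rw [h.mem_stripDomino hF'] at hij
    rw [mem_ofRank, mem_ofRank]
    have h0 := h.zero_or_one (c - 1)
    have h1 := h.zero_or_one (c + 1)
    have h2 := h.eq c
    have h3 := h.eq (c + 1)
    rw [add_sub_cancel_right] at h3
    rcases hij with ⟨h4, h5⟩ | ⟨h4, h5⟩ <;> rw [h5] <;> omega
  · rintro ⟨i, j⟩ hij hij'
    rw [mem_ofRank] at hij hij'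
    obtain ⟨c, hc⟩ : ∃ c : ℤ, (j : ℤ) - i = c := ⟨_, rfl⟩
    rw [hc] at hij hij'
    have h0 := h.zero_or_one (c - 1)
    have h1 := h.zero_or_one c
    have h2 := h.eq c
    -- On the diagonal c the first new cell is the head of the domino of content c - 1, if that
    -- exists; any other new cell is the foot of the domino of content c.
    by_cases h3 : t (c - 1) = 1 ∧ (i : ℤ) = F' c
    · refine ⟨_, (hS _).mpr ⟨c - 1, h3.1, rfl⟩, ?_⟩
      rw [h.mem_stripDomino hF', sub_add_cancel]
      exact Or.inl ⟨h3.2, hc⟩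
    · have h4 : t c = 1 := by omega
      refine ⟨_, (hS _).mpr ⟨c, h4, rfl⟩, ?_⟩
      rw [h.mem_stripDomino hF']
      refine Or.inr ⟨?_, hc⟩
      omega
  · intro d hd e he i i' j hi hi'
    obtain ⟨c, hc, rfl⟩ := (hS d).mp hd
    obtain ⟨c', hc', rfl⟩ := (hS e).mp he
    rcases lt_trichotomy c c' with hlt | rfl | hlt
    · exact (h.column_lt hF' hc hc' hlt hi hi').elim
    · rfl
    · exact (h.column_lt hF' hc' hc hlt hi' hi).elim

end RankStrip

namespace IsStrip

variable {F' F : ℤ → ℤ} {hF' : IsRank F'} {hF : IsRank F} {S : Finset Domino}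

theorem le_rank (h : IsStrip (ofRank F' hF') (ofRank F hF) S) (c : ℤ) : F' c ≤ F c := by
  refine le_of_forall_natCast_lt (hF.nonneg c) fun i hi => ?_
  rcases lt_or_ge ((i : ℤ) + c) 0 with hc | hc
  · have := hF.neg_le c
    omega
  · have e : c = (((i : ℤ) + c).toNat : ℕ) - (i : ℤ) := by omega
    rw [e, ← mem_ofRank hF'] at hi
    rw [e, ← mem_ofRank hF]
    exact h.le hi

/-- The cell above the head lies in the smaller diagram: a domino of `S` covering it would share a
column with `d`, hence be `d`, whose top row is that of the head. This cell has content one more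
than the head, which forces the two ranks to agree. -/
theorem head_spec (h : IsStrip (ofRank F' hF') (ofRank F hF) S) {d : Domino} (hd : d ∈ S) :
    F' (d.content + 1) = d.1.1 ∧ F' (d.content + 2) = d.1.1 ∧ (d.1.1 : ℤ) < F (d.content + 1) := by
  have h1 := h.inside d hd _ d.head_mem
  rw [mem_ofRank, mem_ofRank, d.headCol_sub] at h1
  have h2 := hF'.anti (d.content + 1)
  rw [show d.content + 1 + 1 = d.content + 2 by ring] at h2
  have h3 : (d.1.1 : ℤ) ≤ F' (d.content + 2) := by
    rcases hr : d.1.1 with _ | i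
    · exact hF'.nonneg _
    · have h4 : (i, d.headCol) ∈ ofRank F hF :=
        (ofRank F hF).up_left_mem (by omega) le_rfl (h.inside d hd _ d.head_mem).1
      by_cases h5 : (i, d.headCol) ∈ ofRank F' hF'
      · rw [mem_ofRank] at h5
        have := d.headCol_sub
        rw [show (d.headCol : ℤ) - i = d.content + 2 by rw [hr] at this; push_cast at this; omega]
          at h5
        push_cast
        omega
      · obtain ⟨e, he, hie⟩ := h.cover _ h4 h5
        have := h.column e he d hd _ _ _ hie d.head_mem
        subst this
        rw [Domino.mem_cells_iff] at hie
        have := e.footRow_eq_or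
        omega
  omega

theorem foot_spec (h : IsStrip (ofRank F' hF') (ofRank F hF) S) {d : Domino} (hd : d ∈ S) :
    F' d.content ≤ d.footRow ∧ (d.footRow : ℤ) < F d.content := by
  have h1 := h.inside d hd _ d.foot_mem
  rw [mem_ofRank, mem_ofRank] at h1
  exact ⟨not_lt.mp h1.2, h1.1⟩

theorem exists_of_lt (h : IsStrip (ofRank F' hF') (ofRank F hF) S) {c r : ℤ} (h1 : F' c ≤ r)
    (h2 : r < F c) : ∃ d ∈ S, (d.content = c - 1 ∧ (d.1.1 : ℤ) = r) ∨
      (d.content = c ∧ (d.footRow : ℤ) = r) := by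
  have h3 := hF'.neg_le c
  have h4 := hF'.nonneg c
  have e : c = ((r + c).toNat : ℕ) - (r.toNat : ℤ) := by omega
  have h5 : (r.toNat, (r + c).toNat) ∈ ofRank F hF := by
    rw [mem_ofRank, ← e]; omega
  have h6 : (r.toNat, (r + c).toNat) ∉ ofRank F' hF' := by
    rw [mem_ofRank, ← e]; omega
  obtain ⟨d, hd, hm⟩ := h.cover _ h5 h6
  refine ⟨d, hd, ?_⟩
  rw [Domino.mem_cells_iff] at hm
  have := d.headCol_sub
  have : d.content = (d.1.2 : ℤ) - d.footRow := rfl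
  omega

theorem content_injOn (h : IsStrip (ofRank F' hF') (ofRank F hF) S) {d e : Domino} (hd : d ∈ S)
    (he : e ∈ S) (hde : d.content = e.content) : d = e := by
  refine h.column d hd e he d.1.1 e.1.1 d.headCol d.head_mem ?_
  have h1 := (h.head_spec hd).1
  have h2 := (h.head_spec he).1
  have h3 := d.headCol_sub
  have h4 := e.headCol_sub
  rw [hde] at h1
  rw [show d.headCol = e.headCol by omega]
  exact e.head_mem

theorem head_ne_foot (h : IsStrip (ofRank F' hF') (ofRank F hF) S) {d e : Domino} (hd : d ∈ S)
    (he : e ∈ S) (hde : d.content = e.content - 1) : (d.1.1 : ℤ) ≠ e.footRow := by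
  intro heq
  have h3 := d.headCol_sub
  have h4 : e.content = (e.1.2 : ℤ) - e.footRow := rfl
  have : d = e := by
    refine h.column d hd e he d.1.1 e.footRow d.headCol d.head_mem ?_
    rw [show d.headCol = e.1.2 by omega]
    exact e.foot_mem
  subst this
  omega

open Classical in
/-- The number of dominoes of content `c`. -/
noncomputable def count (S : Finset Domino) (c : ℤ) : ℤ :=
  if ∃ d ∈ S, d.content = c then 1 else 0

/-- New cells on the diagonal c are heads of content c - 1 or feet of content c, and there is at
most one of each. A head occupies row `F' c`, so a foot takes the next row if there is a head and
row `F' c` otherwise. -/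
theorem count_spec (h : IsStrip (ofRank F' hF') (ofRank F hF) S) (c : ℤ) :
    F c = F' c + count S (c - 1) + count S c ∧
      ∀ d ∈ S, d.content = c → (d.footRow : ℤ) = F' c + count S (c - 1) := by
  have hle := h.le_rank c
  have hex := fun r => h.exists_of_lt (c := c) (r := r)
  by_cases h1 : ∃ d ∈ S, d.content = c - 1 <;> by_cases h2 : ∃ d ∈ S, d.content = c
  · rw [count, count, if_pos h1, if_pos h2]
    obtain ⟨d, hd, hdc⟩ := h1
    obtain ⟨e, he, hec⟩ := h2
    have a1 := h.head_spec hd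
    have a2 := h.foot_spec he
    have a3 := h.head_ne_foot hd he (by omega)
    rw [hdc, sub_add_cancel] at a1
    rw [hec] at a2
    have hex' : ∀ r, F' c ≤ r → r < F c → r = d.1.1 ∨ r = e.footRow := by
      intro r hr hr'
      obtain ⟨f, hf, ⟨h3, h4⟩ | ⟨h3, h4⟩⟩ := hex r hr hr'
      · have := h.content_injOn hd hf (by omega)
        subst this; omega
      · have := h.content_injOn he hf (by omega)
        subst this; omega
    have a4 := hex' (F' c + 1) (by omega) (by omega)
    have a5 : F c = F' c + 2 := by
      by_contra hne
      have a5 := hex' (F' c + 2) (by omega) (by omega)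
      omega
    refine ⟨by omega, fun e' he' hec' => ?_⟩
    have := h.content_injOn he he' (by omega)
    subst this
    omega
  · rw [count, count, if_pos h1, if_neg h2]
    obtain ⟨d, hd, hdc⟩ := h1
    have a1 := h.head_spec hd
    rw [hdc, sub_add_cancel] at a1
    refine ⟨?_, fun e' he' hec' => (h2 ⟨e', he', hec'⟩).elim⟩
    by_contra hne
    obtain ⟨f, hf, ⟨h3, h4⟩ | ⟨h3, h4⟩⟩ := hex (F' c + 1) (by omega) (by omega)
    · have := h.content_injOn hd hf (by omega)
      subst this; omega
    · exact h2 ⟨f, hf, h3⟩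
  · rw [count, count, if_neg h1, if_pos h2]
    obtain ⟨e, he, hec⟩ := h2
    have a2 := h.foot_spec he
    rw [hec] at a2
    have hex' : ∀ r, F' c ≤ r → r < F c → r = e.footRow := by
      intro r hr hr'
      obtain ⟨f, hf, ⟨h3, h4⟩ | ⟨h3, h4⟩⟩ := hex r hr hr'
      · exact (h1 ⟨f, hf, h3⟩).elim
      · have := h.content_injOn he hf (by omega)
        subst this; omega
    have a4 := hex' (F' c) (by omega) (by omega)
    refine ⟨?_, fun e' he' hec' => ?_⟩
    · by_contra hne
      have a5 := hex' (F' c + 1) (by omega) (by omega)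
      omega
    · have := h.content_injOn he he' (by omega)
      subst this
      omega
  · rw [count, count, if_neg h1, if_neg h2]
    refine ⟨?_, fun e' he' hec' => (h2 ⟨e', he', hec'⟩).elim⟩
    by_contra hne
    obtain ⟨f, hf, ⟨h3, h4⟩ | ⟨h3, h4⟩⟩ := hex (F' c) (by omega) (by omega)
    · exact h1 ⟨f, hf, h3⟩
    · exact h2 ⟨f, hf, h3⟩

theorem rankStrip (h : IsStrip (ofRank F' hF') (ofRank F hF) S) : RankStrip F' F (count S) where
  zero_or_one c := by
    unfold count
    split_ifs <;> simp
  eq c := (h.count_spec c).1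
  flat c hc := by
    unfold count at hc
    split_ifs at hc with h1
    · obtain ⟨d, hd, rfl⟩ := h1
      have := h.head_spec hd
      omega
    · simp at hc

theorem mem_iff (h : IsStrip (ofRank F' hF') (ofRank F hF) S) (d : Domino) :
    d ∈ S ↔ ∃ c, count S c = 1 ∧ d = stripDomino F' (count S) c := by
  have key : ∀ d ∈ S, d = stripDomino F' (count S) d.content := by
    intro d hd
    have h1 := (h.head_spec hd).1
    have h2 := (h.count_spec d.content).2 d hd rfl
    have h3 := d.headCol_sub
    unfold stripDomino
    rw [h1, ← h2]
    obtain ⟨⟨i, j⟩, v⟩ := d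
    cases v
    · simp only [Domino.footRow, Domino.headCol, Bool.false_eq_true, if_false, if_true] at h3 ⊢
      push_cast at h3
      simp only [Prod.mk.injEq, and_true]
      omega
    · simp only [Domino.footRow, Domino.headCol, if_true] at h3 ⊢
      rw [if_neg (by push_cast; omega)]
      simp only [Prod.mk.injEq, and_true]
      omega
  constructor
  · intro hd
    refine ⟨d.content, ?_, key d hd⟩
    exact if_pos ⟨d, hd, rfl⟩
  · rintro ⟨c, hc, rfl⟩
    unfold count at hc
    split_ifs at hc with h1
    · obtain ⟨e, he, rfl⟩ := h1
      rwa [← key e he]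
    · simp at hc

theorem eq_of_isStrip {S' : Finset Domino} (h : IsStrip (ofRank F' hF') (ofRank F hF) S)
    (h' : IsStrip (ofRank F' hF') (ofRank F hF) S') : S = S' := by
  have := h.rankStrip.unique h'.rankStrip hF' hF
  ext d
  rw [h.mem_iff, h'.mem_iff, this]

theorem card_eq {lam' lam : YoungDiagram} (h : IsStrip lam' lam S) :
    lam.card = lam'.card + 2 * S.card := by
  classical
  have h1 : lam.cells = lam'.cells ∪ S.biUnion Domino.cells := by
    ext c
    simp only [Finset.mem_union, Finset.mem_biUnion, YoungDiagram.mem_cells]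
    constructor
    · intro hc
      by_cases hc' : c ∈ lam'
      · exact Or.inl hc'
      · exact Or.inr (h.cover c hc hc')
    · rintro (hc | ⟨d, hd, hc⟩)
      · exact h.le hc
      · exact (h.inside d hd c hc).1
  have h2 : Disjoint lam'.cells (S.biUnion Domino.cells) := by
    rw [Finset.disjoint_left]
    intro c hc hc'
    simp only [Finset.mem_biUnion] at hc'
    obtain ⟨d, hd, hcd⟩ := hc'
    exact (h.inside d hd c hcd).2 hc
  rw [YoungDiagram.card, h1, Finset.card_union_of_disjoint h2, Finset.card_biUnion]
  · simp [Domino.card_cells, mul_comm]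
  · intro d hd e he hde
    rw [Function.onFun, Finset.disjoint_left]
    rintro ⟨i, j⟩ hc hc'
    exact hde (h.column d hd e he i i j hc hc')

end IsStrip

/-! ### Domino strips and 2-quotients -/

/-- The numbers of dominoes of given content in a strip between two Young diagrams with given
2-quotients. -/
noncomputable def quotientDiff (a' b' a b : ℕ →₀ ℕ) (c : ℤ) : ℤ :=
  if c % 2 = 0 then seqRank a (c / 2) - seqRank a' (c / 2)
  else seqRank b ((c + 1) / 2) - seqRank b' ((c + 1) / 2)

section

variable {a b a' b' : ℕ →₀ ℕ}

theorem quotientDiff_two_mul (k : ℤ) :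
    quotientDiff a' b' a b (2 * k) = seqRank a k - seqRank a' k := by
  rw [quotientDiff, if_pos (by omega), show 2 * k / 2 = k by omega]

theorem quotientDiff_two_mul_sub_one (k : ℤ) :
    quotientDiff a' b' a b (2 * k - 1) = seqRank b k - seqRank b' k := by
  rw [quotientDiff, if_neg (by omega), show (2 * k - 1 + 1) / 2 = k by omega]

/-- Dominoes of even content see only `a`, those of odd content only `b`. The inequality `κ ≤ ν` and
the second interlacing inequality bound the differences by 0 and 1, and the second one also gives
flatness. -/
theorem rankStrip_of_interlace (ha : Interlace a' a) (hb : Interlace b' b) :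
    RankStrip (dominoRank a' b') (dominoRank a b) (quotientDiff a' b' a b) := by
  have hA := (interlace_iff_seqRank ha.antitone_left ha.antitone_right).mp ha
  have hB := (interlace_iff_seqRank hb.antitone_left hb.antitone_right).mp hb
  have hA' := isRank_seqRank ha.antitone_left
  have hB' := isRank_seqRank hb.antitone_left
  refine ⟨fun c => ?_, fun c => ?_, fun c => ?_⟩ <;>
    rcases Int.even_or_odd' c with ⟨k, rfl | rfl⟩
  · rw [quotientDiff_two_mul]
    have := hA k; have := hA'.anti k; omega
  · rw [show 2 * k + 1 = 2 * (k + 1) - 1 by ring, quotientDiff_two_mul_sub_one]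
    have := hB (k + 1); have := hB'.anti (k + 1); omega
  · rw [quotientDiff_two_mul, quotientDiff_two_mul_sub_one, dominoRank_two_mul, dominoRank_two_mul]
    ring
  · rw [dominoRank_two_mul_add_one, dominoRank_two_mul_add_one,
      show 2 * k + 1 - 1 = 2 * k by ring, quotientDiff_two_mul,
      show 2 * k + 1 = 2 * (k + 1) - 1 by ring, quotientDiff_two_mul_sub_one]
    ring
  · rw [quotientDiff_two_mul, dominoRank_two_mul_add_one, show 2 * k + 2 = 2 * (k + 1) by ring,
      dominoRank_two_mul]
    have := hA k; have := hA'.anti k; omega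
  · rw [show 2 * k + 1 + 2 = 2 * (k + 1) + 1 by ring, show 2 * k + 1 + 1 = 2 * (k + 1) by ring,
      show 2 * k + 1 = 2 * (k + 1) - 1 by ring, quotientDiff_two_mul_sub_one, dominoRank_two_mul,
      dominoRank_two_mul_add_one]
    have := hB (k + 1); have := hB'.anti (k + 1); omega

/-- The smaller quotient is found by subtracting from the rank of `a` the counts of even content and
from that of `b` the counts of odd content. Alternate steps of `F'` show that the results are rank
functions, and flatness gives the interlacing. -/
theorem exists_quotient_of_rankStrip {F' t : ℤ → ℤ} (ha : Antitone a) (hb : Antitone b)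
    (hF' : IsRank F') (h : RankStrip F' (dominoRank a b) t) :
    ∃ a' b', Interlace a' a ∧ Interlace b' b ∧ F' = dominoRank a' b' := by
  have hA := isRank_seqRank ha
  have hB := isRank_seqRank hb
  obtain ⟨C, hC⟩ := h.exists_bound hF' (isRank_dominoRank ha hb)
  obtain ⟨D, hD, hAD⟩ := hA.bound
  obtain ⟨E, hE, hBE⟩ := hB.bound
  have e0 : ∀ k, F' (2 * k) = seqRank a k + seqRank b k - t (2 * k - 1) - t (2 * k) := by
    intro k
    have := h.eq (2 * k)
    rw [dominoRank_two_mul] at this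
    omega
  have e1 : ∀ k, F' (2 * k + 1) = seqRank a k + seqRank b (k + 1) - t (2 * k) - t (2 * k + 1) := by
    intro k
    have := h.eq (2 * k + 1)
    rw [dominoRank_two_mul_add_one, add_sub_cancel_right] at this
    omega
  have e2 : ∀ k, F' (2 * k + 2) =
      seqRank a (k + 1) + seqRank b (k + 1) - t (2 * k + 1) - t (2 * k + 2) := by
    intro k
    have := e0 (k + 1)
    rwa [show 2 * (k + 1) - 1 = 2 * k + 1 by ring, show 2 * (k + 1) = 2 * k + 2 by ring] at this
  have hC0 : ∀ c, C ≤ c → t c = 0 ∧ t (-c) = 0 := by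
    intro c hc
    constructor
    · by_contra h0
      have := hC _ h0; omega
    · by_contra h0
      have := hC _ h0; omega
  have hA' : IsRank fun k => seqRank a k - t (2 * k) := by
    refine ⟨fun k => ?_, fun k => ?_, ⟨D + |C|, by positivity, fun k hk => ?_⟩⟩
    · have h1 := hF'.anti (2 * k + 1)
      rw [show 2 * k + 1 + 1 = 2 * k + 2 by ring, e1, e2] at h1
      simp only [show 2 * (k + 1) = 2 * k + 2 by ring]
      omega
    · have h1 := hF'.step (2 * k + 1)
      rw [show 2 * k + 1 + 1 = 2 * k + 2 by ring, e1, e2] at h1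
      simp only [show 2 * (k + 1) = 2 * k + 2 by ring]
      omega
    · have h1 := le_abs_self C; have h2 := abs_nonneg C
      have h3 := hC0 (2 * k) (by omega)
      have h4 := hAD k (by omega)
      rw [show 2 * -k = -(2 * k) by ring]
      omega
  have hB' : IsRank fun k => seqRank b k - t (2 * k - 1) := by
    refine ⟨fun k => ?_, fun k => ?_, ⟨E + |C| + 1, by positivity, fun k hk => ?_⟩⟩
    · have h1 := hF'.anti (2 * k)
      rw [e1, e0] at h1
      simp only [show 2 * (k + 1) - 1 = 2 * k + 1 by ring]
      omega
    · have h1 := hF'.step (2 * k)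
      rw [e1, e0] at h1
      simp only [show 2 * (k + 1) - 1 = 2 * k + 1 by ring]
      omega
    · have h1 := le_abs_self C; have h2 := abs_nonneg C
      have h3 := hC0 (2 * k - 1) (by omega)
      have h3' := hC0 (2 * k + 1) (by omega)
      have h4 := hBE k (by omega)
      rw [show 2 * -k - 1 = -(2 * k + 1) by ring]
      omega
  obtain ⟨a', ha', hra⟩ := hA'.exists_seqRank_eq
  obtain ⟨b', hb', hrb⟩ := hB'.exists_seqRank_eq
  refine ⟨a', b', ?_, ?_, ?_⟩
  · rw [interlace_iff_seqRank ha' ha, hra]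
    intro k
    have h1 := hA'.step k
    have h2 := h.zero_or_one (2 * k)
    have h3 := h.flat (2 * k)
    rw [e1, e2] at h3
    simp only [show 2 * (k + 1) = 2 * k + 2 by ring] at h1 ⊢
    omega
  · rw [interlace_iff_seqRank hb' hb, hrb]
    intro k
    have h1 := hB'.step k
    have h2 := h.zero_or_one (2 * k - 1)
    have h3 := h.flat (2 * k - 1)
    rw [show 2 * k - 1 + 1 = 2 * k by ring, show 2 * k - 1 + 2 = 2 * k + 1 by ring, e0, e1] at h3
    simp only [show 2 * (k + 1) - 1 = 2 * k + 1 by ring] at h1 ⊢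
    omega
  · funext c
    rcases Int.even_or_odd' c with ⟨k, rfl | rfl⟩
    · rw [dominoRank_two_mul, hra, hrb, e0]; ring
    · rw [dominoRank_two_mul_add_one, hra, hrb, e1]
      simp only [show 2 * (k + 1) - 1 = 2 * k + 1 by ring]
      ring

theorem exists_isStrip_of_interlace (ha : Interlace a' a) (hb : Interlace b' b) :
    ∃ S, IsStrip (dominoShape (a', b')) (dominoShape (a, b)) S := by
  rw [dominoShape_eq ha.antitone_left hb.antitone_left,
    dominoShape_eq ha.antitone_right hb.antitone_right]
  obtain ⟨S, hS, -⟩ := (rankStrip_of_interlace ha hb).exists_isStrip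
    (isRank_dominoRank ha.antitone_left hb.antitone_left)
    (isRank_dominoRank ha.antitone_right hb.antitone_right)
  exact ⟨S, hS⟩

theorem IsStrip.unique {lam' lam : YoungDiagram} {S S' : Finset Domino} (h : IsStrip lam' lam S)
    (h' : IsStrip lam' lam S') : S = S' := by
  obtain ⟨F', hF', rfl⟩ := exists_ofRank_eq lam'
  obtain ⟨F, hF, rfl⟩ := exists_ofRank_eq lam
  exact h.eq_of_isStrip h'

theorem IsStrip.exists_quotient {lam' : YoungDiagram} {S : Finset Domino} (ha : Antitone a)
    (hb : Antitone b) (h : IsStrip lam' (dominoShape (a, b)) S) :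
    ∃ a' b', Interlace a' a ∧ Interlace b' b ∧ lam' = dominoShape (a', b') := by
  obtain ⟨F', hF', rfl⟩ := exists_ofRank_eq lam'
  rw [dominoShape_eq ha hb] at h
  obtain ⟨a', b', ha', hb', rfl⟩ := exists_quotient_of_rankStrip ha hb hF' h.rankStrip
  exact ⟨a', b', ha', hb', (dominoShape_eq ha'.antitone_left hb'.antitone_left).symm⟩

theorem IsStrip.count_eq {S : Finset Domino} (ha : Interlace a' a) (hb : Interlace b' b)
    (h : IsStrip (dominoShape (a', b')) (dominoShape (a, b)) S) :
    IsStrip.count S = quotientDiff a' b' a b := by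
  rw [dominoShape_eq ha.antitone_left hb.antitone_left,
    dominoShape_eq ha.antitone_right hb.antitone_right] at h
  exact h.rankStrip.unique (rankStrip_of_interlace ha hb) (isRank_dominoRank ha.antitone_left hb.antitone_left)
    (isRank_dominoRank ha.antitone_right hb.antitone_right)

/-! ### The size of a Young diagram and the size of its 2-quotient -/

theorem interlace_addBox {r : ℕ} (ha : Antitone a) (h : Antitone (addBox a r)) :
    Interlace a (addBox a r) := by
  intro i
  have h1 := ha (Nat.le_succ i)
  have h2 := h (Nat.le_succ i)
  simp only [Nat.succ_eq_add_one] at h1 h2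
  constructor
  · by_cases hi : i = r
    · subst hi; simp
    · rw [addBox_of_ne a hi]
  · by_cases hi : i = r
    · subst hi
      rwa [addBox_of_ne a (by omega)]
    · rwa [addBox_of_ne a hi] at h2

theorem seqRank_addBox {r : ℕ} (ha : Antitone a) (h : Antitone (addBox a r)) (c : ℤ) :
    seqRank (addBox a r) c = seqRank a c + if c = (a r : ℤ) - r then 1 else 0 := by
  split_ifs with hc
  · have h1 : seqRank a c = r := by
      refine le_antisymm (le_of_forall_natCast_lt (by omega) fun i hi => ?_)
        (le_of_forall_natCast_lt (seqRank_nonneg _ _) fun i hi => ?_)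
      · rw [natCast_lt_seqRank ha] at hi
        by_contra hlt
        have := ha (show r ≤ i by omega)
        omega
      · rw [natCast_lt_seqRank ha]
        have := ha (show i ≤ r by omega)
        omega
    rw [h1]
    refine le_antisymm (le_of_forall_natCast_lt (by omega) fun i hi => ?_)
        (le_of_forall_natCast_lt (seqRank_nonneg _ _) fun i hi => ?_)
    · rw [natCast_lt_seqRank h] at hi
      by_contra hlt
      rw [addBox_of_ne a (by omega)] at hi
      have := ha (show r ≤ i by omega)
      omega
    · rw [natCast_lt_seqRank h]
      have := h (show i ≤ r by omega)
      rw [addBox_self] at this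
      omega
  · rw [add_zero]
    refine le_antisymm (le_of_forall_natCast_lt (seqRank_nonneg _ _) fun i hi => ?_)
      ((le_iff_seqRank_le ha h).mp (interlace_addBox ha h).le c)
    rw [natCast_lt_seqRank h] at hi
    rw [natCast_lt_seqRank ha]
    by_cases hi' : i = r
    · subst hi'
      rw [addBox_self] at hi
      push_cast at hi
      omega
    · rwa [addBox_of_ne a hi'] at hi

theorem isStrip_card_eq_one {S : Finset Domino} (ha : Interlace a' a) (hb : Interlace b' b)
    (h : IsStrip (dominoShape (a', b')) (dominoShape (a, b)) S) (c : ℤ)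
    (hc : ∀ d, quotientDiff a' b' a b d = 1 ↔ d = c) : S.card = 1 := by
  have h1 := h.count_eq ha hb
  rw [dominoShape_eq ha.antitone_left hb.antitone_left,
    dominoShape_eq ha.antitone_right hb.antitone_right] at h
  rw [Finset.card_eq_one]
  refine ⟨stripDomino (dominoRank a' b') (IsStrip.count S) c, ?_⟩
  ext d
  rw [h.mem_iff, Finset.mem_singleton, h1]
  simp only [hc]
  simp

theorem card_dominoShape_addBox_left {r : ℕ} (ha : Antitone a) (h : Antitone (addBox a r))
    (hb : Antitone b) : (dominoShape (addBox a r, b)).card = (dominoShape (a, b)).card + 2 := by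
  have ha' := interlace_addBox ha h
  obtain ⟨S, hS⟩ := exists_isStrip_of_interlace ha' (interlace_self hb)
  rw [hS.card_eq, isStrip_card_eq_one ha' (interlace_self hb) hS (2 * ((a r : ℤ) - r))]
  intro d
  rcases Int.even_or_odd' d with ⟨k, rfl | rfl⟩
  · rw [quotientDiff_two_mul, seqRank_addBox ha h]
    split_ifs <;> omega
  · rw [show 2 * k + 1 = 2 * (k + 1) - 1 by ring, quotientDiff_two_mul_sub_one]
    omega

theorem card_dominoShape_addBox_right {r : ℕ} (ha : Antitone a) (hb : Antitone b)
    (h : Antitone (addBox b r)) :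
    (dominoShape (a, addBox b r)).card = (dominoShape (a, b)).card + 2 := by
  have hb' := interlace_addBox hb h
  obtain ⟨S, hS⟩ := exists_isStrip_of_interlace (interlace_self ha) hb'
  rw [hS.card_eq, isStrip_card_eq_one (interlace_self ha) hb' hS (2 * ((b r : ℤ) - r) - 1)]
  intro d
  rcases Int.even_or_odd' d with ⟨k, rfl | rfl⟩
  · rw [quotientDiff_two_mul]
    omega
  · rw [show 2 * k + 1 = 2 * (k + 1) - 1 by ring, quotientDiff_two_mul_sub_one,
      seqRank_addBox hb h]
    split_ifs <;> omega

theorem exists_addBox_eq (ha : Antitone a) (h0 : a ≠ 0) :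
    ∃ (a₁ : ℕ →₀ ℕ) (r : ℕ), Antitone a₁ ∧ a = addBox a₁ r := by
  have hne : a.support.Nonempty := Finsupp.support_nonempty_iff.mpr h0
  set r := a.support.max' hne with hr
  have h1 : a r ≠ 0 := by
    have := Finset.max'_mem _ hne
    rwa [← hr, Finsupp.mem_support_iff] at this
  have h2 : ∀ i, r < i → a i = 0 := by
    intro i hi
    by_contra hia
    have := Finset.le_max' _ i (Finsupp.mem_support_iff.mpr hia)
    omega
  have h3 : ∀ i, (a - Finsupp.single r 1 : ℕ →₀ ℕ) i = if i = r then a i - 1 else a i := by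
    intro i
    rw [Finsupp.tsub_apply]
    split_ifs with hi
    · rw [hi, Finsupp.single_eq_same]
    · rw [Finsupp.single_eq_of_ne hi, Nat.sub_zero]
  refine ⟨a - Finsupp.single r 1, r, ?_, ?_⟩
  · refine antitone_nat_of_succ_le fun i => ?_
    rw [h3, h3]
    have h4 := ha (Nat.le_succ i)
    have h5 := h2 (i + 1)
    simp only [Nat.succ_eq_add_one] at h4
    split_ifs with h6 h7 h7
    · omega
    · omega
    · have := h5 (by omega); omega
    · exact h4
  · ext i
    by_cases hi : i = r
    · rw [hi, addBox_self, h3, if_pos rfl]; omega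
    · rw [addBox_of_ne _ hi, h3, if_neg hi]

/-- Adding one box to the 2-quotient adds a strip consisting of a single domino. -/
theorem card_dominoShape (ha : Antitone a) (hb : Antitone b) :
    (dominoShape (a, b)).card = 2 * (a.degree + b.degree) := by
  obtain ⟨n, hn⟩ : ∃ n, a.degree + b.degree = n := ⟨_, rfl⟩
  induction n generalizing a b with
  | zero =>
    have h1 : a = 0 := by rw [← Finsupp.degree_eq_zero_iff]; omega
    have h2 : b = 0 := by rw [← Finsupp.degree_eq_zero_iff]; omega
    rw [h1, h2, dominoShape_zero]
    simp
  | succ n ih =>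
    by_cases h0 : a = 0
    · have h1 : b ≠ 0 := by
        rintro rfl
        rw [h0] at hn
        simp at hn
      obtain ⟨b₁, r, hb₁, rfl⟩ := exists_addBox_eq hb h1
      rw [degree_addBox] at hn
      rw [card_dominoShape_addBox_right ha hb₁ hb, ih ha hb₁ (by omega), degree_addBox]
      ring
    · obtain ⟨a₁, r, ha₁, rfl⟩ := exists_addBox_eq ha h0
      rw [degree_addBox] at hn
      rw [card_dominoShape_addBox_left ha₁ ha hb, ih ha₁ hb (by omega), degree_addBox]
      ring

theorem IsStrip.card_eq_degree {S : Finset Domino} (ha : Interlace a' a) (hb : Interlace b' b)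
    (h : IsStrip (dominoShape (a', b')) (dominoShape (a, b)) S) :
    S.card = (a.degree - a'.degree) + (b.degree - b'.degree) := by
  have h1 := h.card_eq
  rw [card_dominoShape ha.antitone_left hb.antitone_left,
    card_dominoShape ha.antitone_right hb.antitone_right] at h1
  have := ha.degree_le
  have := hb.degree_le
  omega

theorem IsStrip.tiling {lam' lam : YoungDiagram} {S T : Finset Domino} (h : IsStrip lam' lam S)
    (hT : IsDominoTiling lam' T) : ∃ T', IsDominoTiling lam T' := by
  classical
  refine ⟨T ∪ S, ?_, ?_⟩
  · intro d hd c hc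
    rcases Finset.mem_union.mp hd with hd | hd
    · exact h.le (hT.1 d hd hc)
    · exact (h.inside d hd c hc).1
  · rintro ⟨i, j⟩ hc
    by_cases hc' : (i, j) ∈ lam'
    · obtain ⟨d, ⟨hd, hcd⟩, hu⟩ := hT.2 _ hc'
      refine ⟨d, ⟨Finset.mem_union_left _ hd, hcd⟩, ?_⟩
      rintro e ⟨he, hce⟩
      rcases Finset.mem_union.mp he with he | he
      · exact hu e ⟨he, hce⟩
      · exact absurd hc' (h.inside e he _ hce).2
    · obtain ⟨d, hd, hcd⟩ := h.cover _ hc hc'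
      refine ⟨d, ⟨Finset.mem_union_right _ hd, hcd⟩, ?_⟩
      rintro e ⟨he, hce⟩
      rcases Finset.mem_union.mp he with he | he
      · exact absurd (hT.1 e he hce) hc'
      · exact h.column e he d hd i i j hce hcd

theorem exists_tiling_dominoShape (ha : Antitone a) (hb : Antitone b) :
    ∃ T, IsDominoTiling (dominoShape (a, b)) T := by
  obtain ⟨n, hn⟩ : ∃ n, a.degree + b.degree = n := ⟨_, rfl⟩
  induction n generalizing a b with
  | zero =>
    have h1 : a = 0 := by rw [← Finsupp.degree_eq_zero_iff]; omega
    have h2 : b = 0 := by rw [← Finsupp.degree_eq_zero_iff]; omega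
    rw [h1, h2, dominoShape_zero]
    exact ⟨∅, by simp, by simp⟩
  | succ n ih =>
    by_cases h0 : a = 0
    · have h1 : b ≠ 0 := by
        rintro rfl
        rw [h0] at hn
        simp at hn
      obtain ⟨b₁, r, hb₁, rfl⟩ := exists_addBox_eq hb h1
      rw [degree_addBox] at hn
      obtain ⟨S, hS⟩ := exists_isStrip_of_interlace (interlace_self ha) (interlace_addBox hb₁ hb)
      obtain ⟨T, hT⟩ := ih ha hb₁ (by omega)
      exact hS.tiling hT
    · obtain ⟨a₁, r, ha₁, rfl⟩ := exists_addBox_eq ha h0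
      rw [degree_addBox] at hn
      obtain ⟨S, hS⟩ := exists_isStrip_of_interlace (interlace_addBox ha₁ ha) (interlace_self hb)
      obtain ⟨T, hT⟩ := ih ha₁ hb (by omega)
      exact hS.tiling hT

theorem dominoShape_mem_P0 (ha : Antitone a) (hb : Antitone b) :
    dominoShape (a, b) ∈ P0 (a.degree + b.degree) :=
  ⟨card_dominoShape ha hb, exists_tiling_dominoShape ha hb⟩

/-- Over the empty diagram, a domino of content -1 is exactly a vertical domino at the corner. Their
number is the rank of `b` at 0, which vanishes only if `b` has no first row. -/
theorem IsStrip.corner_iff {S : Finset Domino} (ha : Interlace 0 a) (hb : Interlace 0 b)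
    (h : IsStrip (dominoShape (0, 0)) (dominoShape (a, b)) S) :
    (∀ d ∈ S, (0, 0) ∈ d.cells → ¬ d.IsVertical) ↔ b = 0 := by
  -- The content -1 is written as 2 * 0 - 1, an odd content, which belongs to `b`.
  have h1 := congrFun (h.count_eq ha hb) (2 * 0 - 1)
  rw [quotientDiff_two_mul_sub_one, seqRank_zero_eq] at h1
  simp only [mul_zero, zero_sub, neg_zero, max_self, sub_zero] at h1
  have hb' := hb.antitone_right
  have h2 : b = 0 ↔ IsStrip.count S (-1) = 0 := by
    rw [h1]
    constructor
    · rintro rfl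
      rw [seqRank_zero_eq]
      simp
    · intro h0
      have h3 : ¬ ((0 : ℕ) : ℤ) < seqRank b 0 := by rw [h0]; simp
      rw [natCast_lt_seqRank hb'] at h3
      ext i
      have := hb' (Nat.zero_le i)
      simp only [Finsupp.coe_zero, Pi.zero_apply]
      omega
  rw [h2]
  unfold IsStrip.count
  rw [dominoShape_eq ha.antitone_left hb.antitone_left,
    dominoShape_eq ha.antitone_right hb.antitone_right] at h
  constructor
  · intro h3
    rw [if_neg]
    rintro ⟨d, hd, hdc⟩
    have h4 := (h.head_spec hd).1
    have h5 := d.headCol_sub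
    rw [hdc] at h4 h5
    rw [show (-1 + 1 : ℤ) = 2 * 0 by norm_num, dominoRank_two_mul, seqRank_zero_eq] at h4
    simp only [neg_zero, max_self, add_zero] at h4
    have h6 : d.headCol = 0 := by omega
    have h7 : (0, 0) ∈ d.cells := by
      have := d.head_mem
      rwa [h6, show d.1.1 = 0 by omega] at this
    have h8 := d.footRow_eq_or
    refine h3 d hd h7 ?_
    unfold Domino.IsVertical
    rcases h8 with h8 | h8
    · omega
    · exact h8.2.2
  · intro h3 d hd h4 h5
    have h6 : ¬ ∃ d ∈ S, d.content = -1 := by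
      intro h6
      rw [if_pos h6] at h3
      exact one_ne_zero h3
    refine h6 ⟨d, hd, ?_⟩
    rw [Domino.mem_cells_iff] at h4
    have h7 := d.headCol_sub
    have h8 : d.content = (d.1.2 : ℤ) - d.footRow := rfl
    rcases d.footRow_eq_or with h9 | h9
    · rw [Domino.IsVertical, h9.2.2] at h5
      exact absurd h5 (by simp)
    · omega

end

/-! ### Semistandard domino tableaux as sequences of strips -/

/-- A semistandard domino tableau, without the condition on the top left corner. -/
structure IsPreSSDT (lam : YoungDiagram) (T : Finset (Domino × ℕ)) : Prop where
  inside : ∀ p ∈ T, p.1.cells ⊆ lam.cells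
  cover : ∀ c ∈ lam.cells, ∃! p, p ∈ T ∧ c ∈ p.1.cells
  row_le : ∀ p ∈ T, ∀ q ∈ T, ∀ i j k : ℕ,
    (i, j) ∈ p.1.cells → (i, k) ∈ q.1.cells → j < k → p.2 ≤ q.2
  col_lt : ∀ p ∈ T, ∀ q ∈ T, p ≠ q → ∀ i j k : ℕ,
    (i, k) ∈ p.1.cells → (j, k) ∈ q.1.cells → i < j → p.2 < q.2

/-- A vertical domino at the top left corner is not labelled `0`. -/
def CornerCondition (T : Finset (Domino × ℕ)) : Prop :=
  ∀ p ∈ T, (0, 0) ∈ p.1.cells → p.1.IsVertical → p.2 ≠ 0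

theorem isSSDT_iff {lam : YoungDiagram} {T : Finset (Domino × ℕ)} :
    IsSSDT lam T ↔ IsPreSSDT lam T ∧ CornerCondition T :=
  ⟨fun h => ⟨⟨h.1, h.2, h.3, h.4⟩, h.5⟩, fun h => ⟨h.1.1, h.1.2, h.1.3, h.1.4, h.2⟩⟩

open Classical in
/-- The tableaux of shape `lam` with labels less than `m`. -/
noncomputable def preTableaux (lam : YoungDiagram) (m : ℕ) : Finset (Finset (Domino × ℕ)) :=
  ((lam.cells ×ˢ (Finset.univ : Finset Bool)) ×ˢ Finset.range m).powerset.filter (IsPreSSDT lam)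

theorem mem_preTableaux {lam : YoungDiagram} {m : ℕ} {T : Finset (Domino × ℕ)} :
    T ∈ preTableaux lam m ↔ IsPreSSDT lam T ∧ ∀ p ∈ T, p.2 < m := by
  simp only [preTableaux, Finset.mem_filter, Finset.mem_powerset]
  constructor
  · rintro ⟨h1, h2⟩
    refine ⟨h2, fun p hp => ?_⟩
    have := h1 hp
    simp only [Finset.mem_product, Finset.mem_range] at this
    exact this.2
  · rintro ⟨h1, h2⟩
    refine ⟨fun p hp => ?_, h1⟩
    simp only [Finset.mem_product, Finset.mem_univ, and_true, Finset.mem_range]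
    exact ⟨h1.inside p hp (Domino.fst_mem_cells p.1), h2 p hp⟩

open Classical in
/-- The tableau obtained by adding a strip of dominoes labelled `m`. -/
noncomputable def extend (T : Finset (Domino × ℕ)) (S : Finset Domino) (m : ℕ) :
    Finset (Domino × ℕ) := T ∪ S.image fun d => (d, m)

theorem mem_extend {T : Finset (Domino × ℕ)} {S : Finset Domino} {m : ℕ} {p : Domino × ℕ} :
    p ∈ extend T S m ↔ p ∈ T ∨ (p.1 ∈ S ∧ p.2 = m) := by
  obtain ⟨d, l⟩ := p
  simp only [extend, Finset.mem_union, Finset.mem_image, Prod.mk.injEq]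
  constructor
  · rintro (h | ⟨e, he, rfl, rfl⟩)
    · exact Or.inl h
    · exact Or.inr ⟨he, rfl⟩
  · rintro (h | ⟨h, rfl⟩)
    · exact Or.inl h
    · exact Or.inr ⟨d, h, rfl, rfl⟩

theorem IsStrip.extend_mem {lam' lam : YoungDiagram} {S : Finset Domino} {m : ℕ}
    {T : Finset (Domino × ℕ)} (h : IsStrip lam' lam S) (hT : T ∈ preTableaux lam' m) :
    extend T S m ∈ preTableaux lam (m + 1) := by
  rw [mem_preTableaux] at hT ⊢
  obtain ⟨hT, hm⟩ := hT
  have hout : ∀ p ∈ T, ∀ d ∈ S, ∀ c, c ∈ p.1.cells → c ∈ d.cells → False :=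
    fun p hp d hd c hc hc' => (h.inside d hd c hc').2 (hT.inside p hp hc)
  refine ⟨⟨?_, ?_, ?_, ?_⟩, ?_⟩
  · intro p hp c hc
    rcases mem_extend.mp hp with hp | ⟨hp, -⟩
    · exact h.le (hT.inside p hp hc)
    · exact (h.inside _ hp c hc).1
  · rintro ⟨i, j⟩ hc
    by_cases hc' : (i, j) ∈ lam'
    · obtain ⟨p, ⟨hp, hcp⟩, hu⟩ := hT.cover _ hc'
      refine ⟨p, ⟨mem_extend.mpr (Or.inl hp), hcp⟩, ?_⟩
      rintro q ⟨hq, hcq⟩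
      rcases mem_extend.mp hq with hq | ⟨hq, -⟩
      · exact hu q ⟨hq, hcq⟩
      · exact (hout p hp _ hq _ hcp hcq).elim
    · obtain ⟨d, hd, hcd⟩ := h.cover _ hc hc'
      refine ⟨(d, m), ⟨mem_extend.mpr (Or.inr ⟨hd, rfl⟩), hcd⟩, ?_⟩
      rintro ⟨e, l⟩ ⟨hq, hcq⟩
      rcases mem_extend.mp hq with hq | ⟨hq, hl⟩
      · exact absurd (hT.inside _ hq hcq) hc'
      · have := h.column e hq d hd i i j hcq hcd
        simp only at hl
        rw [this, hl]
  · intro p hp q hq i j k hpc hqc hjk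
    rcases mem_extend.mp hp with hp | ⟨hp, hpm⟩ <;> rcases mem_extend.mp hq with hq | ⟨hq, hqm⟩
    · exact hT.row_le p hp q hq i j k hpc hqc hjk
    · rw [hqm]
      exact (hm p hp).le
    · have h1 : (i, k) ∈ lam' := hT.inside q hq hqc
      exact absurd (lam'.up_left_mem le_rfl hjk.le h1) (h.inside _ hp _ hpc).2
    · rw [hpm, hqm]
  · intro p hp q hq hpq i j k hpc hqc hij
    rcases mem_extend.mp hp with hp | ⟨hp, hpm⟩ <;> rcases mem_extend.mp hq with hq | ⟨hq, hqm⟩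
    · exact hT.col_lt p hp q hq hpq i j k hpc hqc hij
    · rw [hqm]
      exact hm p hp
    · have h1 : (j, k) ∈ lam' := hT.inside q hq hqc
      exact absurd (lam'.up_left_mem hij.le le_rfl h1) (h.inside _ hp _ hpc).2
    · exact absurd (Prod.ext (h.column _ hp _ hq i j k hpc hqc) (hpm.trans hqm.symm)) hpq
  · intro p hp
    rcases mem_extend.mp hp with hp | ⟨hp, hpm⟩
    · have := hm p hp; omega
    · omega

theorem exists_extend_eq {lam : YoungDiagram} {m : ℕ} {T : Finset (Domino × ℕ)}
    (hT : T ∈ preTableaux lam (m + 1)) : ∃ (lam' : YoungDiagram) (S : Finset Domino)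
      (T' : Finset (Domino × ℕ)), IsStrip lam' lam S ∧ T' ∈ preTableaux lam' m ∧
        T = extend T' S m := by
  classical
  rw [mem_preTableaux] at hT
  obtain ⟨hT, hm⟩ := hT
  -- Labels do not increase when going up from (i, j) to (i', j) and then left to (i', j'). Hence
  -- the labels `< m` occupy a Young diagram.
  have hlow : ∀ p ∈ T, p.2 < m → ∀ c ∈ p.1.cells, ∀ c' ≤ c, ∀ q ∈ T, c' ∈ q.1.cells → q.2 < m := by
    rintro p hp hpm ⟨i, j⟩ hc ⟨i', j'⟩ hle q hq hc'
    obtain ⟨hi, hj⟩ := Prod.mk_le_mk.mp hle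
    have h1 : (i', j) ∈ lam.cells := lam.up_left_mem hi le_rfl (hT.inside p hp hc)
    obtain ⟨r, ⟨hr, hcr⟩, -⟩ := hT.cover _ h1
    have h2 : r.2 ≤ p.2 := by
      by_cases hrp : r = p
      · rw [hrp]
      · rcases Nat.lt_or_ge i' i with h3 | h3
        · exact (hT.col_lt r hr p hp hrp i' i j hcr hc h3).le
        · have h4 : i' = i := le_antisymm hi h3
          subst h4
          exact absurd ((hT.cover _ h1).unique ⟨hr, hcr⟩ ⟨hp, hc⟩) hrp
    have h3 : q.2 ≤ r.2 := by
      rcases Nat.lt_or_ge j' j with h3 | h3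
      · exact hT.row_le q hq r hr i' j' j hc' hcr h3
      · have h4 : j' = j := le_antisymm hj h3
        subst h4
        rw [(hT.cover _ h1).unique ⟨hr, hcr⟩ ⟨hq, hc'⟩]
    omega
  let T' := T.filter fun p => p.2 < m
  have hT' : ∀ p, p ∈ T' ↔ p ∈ T ∧ p.2 < m := fun p => Finset.mem_filter
  let lam' : YoungDiagram := ⟨T'.biUnion fun p => p.1.cells, by
    intro c c' hle hc
    simp only [Finset.coe_biUnion, Set.mem_iUnion, Finset.mem_coe] at hc ⊢
    obtain ⟨p, hp, hpc⟩ := hc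
    obtain ⟨hp, hpm⟩ := (hT' p).mp hp
    have h1 : c' ∈ lam.cells := lam.isLowerSet hle (hT.inside p hp hpc)
    obtain ⟨q, ⟨hq, hcq⟩, -⟩ := hT.cover _ h1
    exact ⟨q, (hT' q).mpr ⟨hq, hlow p hp hpm c hpc c' hle q hq hcq⟩, hcq⟩⟩
  have hlam' : ∀ c, c ∈ lam' ↔ ∃ p ∈ T, p.2 < m ∧ c ∈ p.1.cells := by
    intro c
    rw [← YoungDiagram.mem_cells]
    simp only [lam', Finset.mem_biUnion, hT', and_assoc]
  let S := (T.filter fun p => p.2 = m).image Prod.fst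
  have hS : ∀ d, d ∈ S ↔ (d, m) ∈ T := by
    intro d
    simp only [S, Finset.mem_image, Finset.mem_filter]
    constructor
    · rintro ⟨⟨e, l⟩, ⟨he, rfl⟩, rfl⟩
      exact he
    · intro h
      exact ⟨(d, m), ⟨h, rfl⟩, rfl⟩
  refine ⟨lam', S, T', ⟨?_, ?_, ?_, ?_⟩, ?_, ?_⟩
  · intro c hc
    obtain ⟨p, hp, -, hpc⟩ := (hlam' c).mp hc
    exact hT.inside p hp hpc
  · intro d hd c hc
    rw [hS] at hd
    refine ⟨hT.inside _ hd hc, fun hc' => ?_⟩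
    obtain ⟨p, hp, hpm, hpc⟩ := (hlam' c).mp hc'
    have := (hT.cover c (hT.inside _ hd hc)).unique ⟨hd, hc⟩ ⟨hp, hpc⟩
    rw [← this] at hpm
    exact lt_irrefl _ hpm
  · intro c hc hc'
    obtain ⟨⟨d, l⟩, ⟨hp, hpc⟩, -⟩ := hT.cover c hc
    have h1 := hm _ hp
    have h2 : ¬ l < m := fun hl => hc' ((hlam' c).mpr ⟨_, hp, hl, hpc⟩)
    have h3 : l = m := by simp only at h1; omega
    subst h3
    exact ⟨d, (hS d).mpr hp, hpc⟩
  · intro d hd e he i i' j hi hi'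
    rw [hS] at hd he
    by_contra hde
    have hne : (d, m) ≠ (e, m) := fun h => hde (congrArg Prod.fst h)
    rcases lt_trichotomy i i' with hlt | rfl | hlt
    · have := hT.col_lt _ hd _ he hne i i' j hi hi' hlt
      exact lt_irrefl _ this
    · exact hne ((hT.cover _ (hT.inside _ hd hi)).unique ⟨hd, hi⟩ ⟨he, hi'⟩)
    · have := hT.col_lt _ he _ hd hne.symm i' i j hi' hi hlt
      exact lt_irrefl _ this
  · rw [mem_preTableaux]
    refine ⟨⟨?_, ?_, ?_, ?_⟩, fun p hp => ((hT' p).mp hp).2⟩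
    · intro p hp c hc
      obtain ⟨hp, hpm⟩ := (hT' p).mp hp
      exact (hlam' c).mpr ⟨p, hp, hpm, hc⟩
    · intro c hc
      obtain ⟨p, hp, hpm, hpc⟩ := (hlam' c).mp hc
      refine ⟨p, ⟨(hT' p).mpr ⟨hp, hpm⟩, hpc⟩, ?_⟩
      rintro q ⟨hq, hqc⟩
      exact (hT.cover c (hT.inside p hp hpc)).unique ⟨((hT' q).mp hq).1, hqc⟩ ⟨hp, hpc⟩
    · intro p hp q hq
      exact hT.row_le p ((hT' p).mp hp).1 q ((hT' q).mp hq).1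
    · intro p hp q hq
      exact hT.col_lt p ((hT' p).mp hp).1 q ((hT' q).mp hq).1
  · ext ⟨d, l⟩
    rw [mem_extend, hT', hS]
    constructor
    · intro h
      have h1 := hm _ h
      simp only at h1 ⊢
      rcases Nat.lt_or_ge l m with hl | hl
      · exact Or.inl ⟨h, hl⟩
      · have hl' : l = m := by omega
        subst hl'
        exact Or.inr ⟨h, rfl⟩
    · rintro (h | ⟨h, hl⟩)
      · exact h.1
      · simp only at h hl
        rwa [hl]

theorem extend_injective {lam' lam₁' : YoungDiagram} {m : ℕ} {T T₁ : Finset (Domino × ℕ)}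
    {S S₁ : Finset Domino} (hT : T ∈ preTableaux lam' m) (hT₁ : T₁ ∈ preTableaux lam₁' m)
    (h : extend T S m = extend T₁ S₁ m) : lam' = lam₁' ∧ T = T₁ := by
  rw [mem_preTableaux] at hT hT₁
  have h1 : T = T₁ := by
    ext p
    have h2 : p ∈ extend T S m ↔ p ∈ extend T₁ S₁ m := by rw [h]
    rw [mem_extend, mem_extend] at h2
    constructor
    · intro hp
      have := hT.2 p hp
      rcases h2.mp (Or.inl hp) with h3 | h3
      · exact h3
      · omega
    · intro hp
      have := hT₁.2 p hp
      rcases h2.mpr (Or.inl hp) with h3 | h3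
      · exact h3
      · omega
  refine ⟨?_, h1⟩
  subst h1
  ext c
  constructor
  · intro hc
    obtain ⟨p, ⟨hp, hpc⟩, -⟩ := hT.1.cover c hc
    exact hT₁.1.inside p hp hpc
  · intro hc
    obtain ⟨p, ⟨hp, hpc⟩, -⟩ := hT₁.1.cover c hc
    exact hT.1.inside p hp hpc

open Classical in
/-- The strip between two Young diagrams, when it exists. -/
noncomputable def theStrip (lam' lam : YoungDiagram) : Finset Domino :=
  if h : ∃ S, IsStrip lam' lam S then h.choose else ∅

theorem isStrip_theStrip {lam' lam : YoungDiagram} (h : ∃ S, IsStrip lam' lam S) :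
    IsStrip lam' lam (theStrip lam' lam) := by
  rw [theStrip, dif_pos h]
  exact h.choose_spec

/-- Removing the dominoes with the largest label leaves a tableau of some 2-quotient `z`. Horizontal
strips govern which `z` occur, and the removed strip is determined by the shapes, so the recursion
is that of a pair of Schur polynomials. -/
theorem sum_preTableaux_succ {M : Type*} [AddCommMonoid M] (g : Finset (Domino × ℕ) → M)
    {a b : ℕ →₀ ℕ} (ha : Antitone a) (hb : Antitone b) (m : ℕ) :
    ∑ T ∈ preTableaux (dominoShape (a, b)) (m + 1), g T =
      ∑ z ∈ lowerStrips a ×ˢ lowerStrips b, ∑ T ∈ preTableaux (dominoShape z) m,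
        g (extend T (theStrip (dominoShape z) (dominoShape (a, b))) m) := by
  rw [Finset.sum_sigma']
  symm
  refine Finset.sum_bij
    (fun p _ => extend p.2 (theStrip (dominoShape p.1) (dominoShape (a, b))) m) ?_ ?_ ?_
    fun _ _ => rfl
  · rintro ⟨⟨a', b'⟩, T⟩ h
    simp only [Finset.mem_sigma, Finset.mem_product, mem_lowerStrips] at h
    exact (isStrip_theStrip (exists_isStrip_of_interlace h.1.1 h.1.2)).extend_mem h.2
  · rintro ⟨⟨a', b'⟩, T⟩ h ⟨⟨a₁, b₁⟩, T₁⟩ h₁ e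
    simp only [Finset.mem_sigma, Finset.mem_product, mem_lowerStrips] at h h₁
    obtain ⟨e1, e2⟩ := extend_injective h.2 h₁.2 e
    obtain ⟨e3, e4⟩ := dominoShape_injective h.1.1.antitone_left h.1.2.antitone_left
      h₁.1.1.antitone_left h₁.1.2.antitone_left e1
    subst e2 e3 e4
    rfl
  · intro T hT
    obtain ⟨lam', S, T', hS, hT', rfl⟩ := exists_extend_eq hT
    obtain ⟨a', b', ha', hb', rfl⟩ := hS.exists_quotient ha hb
    refine ⟨⟨(a', b'), T'⟩, ?_, ?_⟩
    · simp only [Finset.mem_sigma, Finset.mem_product, mem_lowerStrips]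
      exact ⟨⟨ha', hb'⟩, hT'⟩
    · simp only
      rw [(isStrip_theStrip ⟨S, hS⟩).unique hS]

theorem mem_preTableaux_zero {lam : YoungDiagram} {T : Finset (Domino × ℕ)} :
    T ∈ preTableaux lam 0 ↔ lam = ⊥ ∧ T = ∅ := by
  rw [mem_preTableaux]
  constructor
  · rintro ⟨h1, h2⟩
    have h3 : T = ∅ := Finset.eq_empty_of_forall_notMem fun p hp => by simpa using h2 p hp
    refine ⟨?_, h3⟩
    subst h3
    ext c
    simp only [YoungDiagram.cells_bot, Finset.notMem_empty, iff_false]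
    intro hc
    obtain ⟨p, ⟨hp, -⟩, -⟩ := h1.cover c hc
    simp at hp
  · rintro ⟨rfl, rfl⟩
    exact ⟨⟨by simp, by simp, by simp, by simp⟩, by simp⟩

theorem cornerCondition_extend {T : Finset (Domino × ℕ)} {S : Finset Domino} {m : ℕ} :
    CornerCondition (extend T S (m + 1)) ↔ CornerCondition T := by
  constructor
  · intro h p hp
    exact h p (mem_extend.mpr (Or.inl hp))
  · intro h p hp
    rcases mem_extend.mp hp with hp | ⟨-, hp⟩
    · exact h p hp
    · intro _ _
      omega

theorem cornerCondition_extend_zero {S : Finset Domino} :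
    CornerCondition (extend ∅ S 0) ↔ ∀ d ∈ S, (0, 0) ∈ d.cells → ¬ d.IsVertical := by
  constructor
  · intro h d hd hc hv
    exact h (d, 0) (mem_extend.mpr (Or.inr ⟨hd, rfl⟩)) hc hv rfl
  · intro h p hp hc hv
    rcases mem_extend.mp hp with hp | ⟨hp, -⟩
    · simp at hp
    · exact absurd hv (h p.1 hp hc)

/-! ### Factorization of domino polynomials -/

section Weight

variable {R : Type} [CommRing R] (x : ℕ → R)

theorem prod_extend {lam' : YoungDiagram} {m : ℕ} {T : Finset (Domino × ℕ)}
    (hT : T ∈ preTableaux lam' m) (S : Finset Domino) :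
    ∏ p ∈ extend T S m, x p.2 = x m ^ S.card * ∏ p ∈ T, x p.2 := by
  classical
  rw [mem_preTableaux] at hT
  rw [extend, Finset.prod_union, mul_comm, Finset.prod_image]
  · simp
  · intro d _ e _ h
    exact congrArg Prod.fst h
  · rw [Finset.disjoint_left]
    intro p hp hp'
    obtain ⟨d, -, rfl⟩ := Finset.mem_image.mp hp'
    exact lt_irrefl _ (hT.2 _ hp)

open Classical in
/-- The generating polynomial of the semistandard domino tableaux of shape `lam` with labels less
than `m`. -/
noncomputable def dominoPolynomial (m : ℕ) (lam : YoungDiagram) : R :=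
  ∑ T ∈ preTableaux lam m, if CornerCondition T then ∏ p ∈ T, x p.2 else 0

/-- The domino functions are products of two Schur functions. -/
theorem dominoPolynomial_eq_bischur (m : ℕ) {a b : ℕ →₀ ℕ} (ha : Antitone a) (hb : Antitone b) :
    dominoPolynomial x (m + 1) (dominoShape (a, b)) = bischur x m (a, b) := by
  classical
  induction m generalizing a b with
  | zero =>
    have h0 : Antitone (0 : ℕ →₀ ℕ) := fun _ _ _ => le_rfl
    rw [dominoPolynomial, sum_preTableaux_succ _ ha hb, bischur]
    simp only [schur]
    -- With the single label 0 the tableau is one strip over the empty diagram. The corner condition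
    -- forces `b = 0`, which is the Schur polynomial of `b` in no variables.
    have key : ∀ z ∈ lowerStrips a ×ˢ lowerStrips b, (∑ T ∈ preTableaux (dominoShape z) 0,
        if CornerCondition (extend T (theStrip (dominoShape z) (dominoShape (a, b))) 0) then
          ∏ p ∈ extend T (theStrip (dominoShape z) (dominoShape (a, b))) 0, x p.2 else 0) =
        (x 0 ^ (a.degree - z.1.degree) * if z.1 = 0 then 1 else 0) *
          (if b = 0 then 1 else 0) * if z.2 = 0 then 1 else 0 := by
      rintro ⟨a', b'⟩ hz
      simp only [Finset.mem_product, mem_lowerStrips] at hz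
      by_cases hab : a' = 0 ∧ b' = 0
      · obtain ⟨rfl, rfl⟩ := hab
        have h1 : preTableaux (dominoShape (0, 0)) 0 = {∅} := by
          ext T
          rw [mem_preTableaux_zero, dominoShape_zero]
          simp
        have hS := isStrip_theStrip (exists_isStrip_of_interlace hz.1 hz.2)
        rw [h1, Finset.sum_singleton, cornerCondition_extend_zero, hS.corner_iff hz.1 hz.2,
          prod_extend (lam' := dominoShape (0, 0)) x (by rw [h1]; simp), hS.card_eq_degree hz.1 hz.2]
        by_cases hb0 : b = 0 <;> simp [hb0]
      · have h1 : preTableaux (dominoShape (a', b')) 0 = ∅ := by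
          rw [Finset.eq_empty_iff_forall_notMem]
          intro T hT
          rw [mem_preTableaux_zero, ← dominoShape_zero] at hT
          exact hab (dominoShape_injective hz.1.antitone_left hz.2.antitone_left h0 h0 hT.1)
        rw [h1, Finset.sum_empty]
        rcases not_and_or.mp hab with h2 | h2 <;> simp [h2]
    rw [Finset.sum_congr rfl key, Finset.sum_product, Finset.sum_mul]
    refine Finset.sum_congr rfl fun a' _ => ?_
    by_cases hb0 : b = 0
    · have h1 : lowerStrips (0 : ℕ →₀ ℕ) = {0} := by
        ext κ
        rw [mem_lowerStrips, Finset.mem_singleton]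
        constructor
        · intro h
          exact le_antisymm h.le (by simp)
        · rintro rfl
          exact interlace_self h0
      subst hb0
      rw [h1]
      simp
    · simp [hb0]
  | succ m ih =>
    rw [dominoPolynomial, sum_preTableaux_succ _ ha hb]
    -- The strip of label m + 1 never affects the corner condition. Its size is the sum of the sizes
    -- of the two horizontal strips, both weighted by `x (m + 1)`: the shift of the second alphabet
    -- compensates for its having one variable less.
    have key : ∀ z ∈ lowerStrips a ×ˢ lowerStrips b, (∑ T ∈ preTableaux (dominoShape z) (m + 1),
        if CornerCondition (extend T (theStrip (dominoShape z) (dominoShape (a, b))) (m + 1)) then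
          ∏ p ∈ extend T (theStrip (dominoShape z) (dominoShape (a, b))) (m + 1), x p.2 else 0) =
        (x (m + 1) ^ (a.degree - z.1.degree) * schur x (m + 1) z.1) *
          (x (m + 1) ^ (b.degree - z.2.degree) * schur (fun i => x (i + 1)) m z.2) := by
      rintro ⟨a', b'⟩ hz
      simp only [Finset.mem_product, mem_lowerStrips] at hz
      have hS := isStrip_theStrip (exists_isStrip_of_interlace hz.1 hz.2)
      have h1 := ih hz.1.antitone_left hz.2.antitone_left
      rw [bischur, dominoPolynomial] at h1
      have h2 : ∀ T ∈ preTableaux (dominoShape (a', b')) (m + 1),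
          (if CornerCondition (extend T
              (theStrip (dominoShape (a', b')) (dominoShape (a, b))) (m + 1)) then
            ∏ p ∈ extend T (theStrip (dominoShape (a', b')) (dominoShape (a, b))) (m + 1), x p.2
            else 0) = x (m + 1) ^ (a.degree - a'.degree + (b.degree - b'.degree)) *
              if CornerCondition T then ∏ p ∈ T, x p.2 else 0 := by
        intro T hT
        simp only [cornerCondition_extend, prod_extend x hT, hS.card_eq_degree hz.1 hz.2]
        split_ifs <;> simp
      rw [Finset.sum_congr rfl h2, ← Finset.mul_sum, h1, pow_add]
      simp only
      ring
    rw [Finset.sum_congr rfl key, Finset.sum_product, bischur, schur, schur, Finset.sum_mul_sum]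

end Weight

/-! ### Coefficients of domino functions -/

theorem prod_X_eq_monomial {ι : Type*} (s : Finset ι) (f : ι → ℕ) :
    ∏ i ∈ s, (MvPolynomial.X (f i) : MvPolynomial ℕ ℂ) =
      MvPolynomial.monomial (∑ i ∈ s, Finsupp.single (f i) 1) 1 := by
  classical
  induction s using Finset.induction_on with
  | empty => simp
  | insert a s ha ih =>
    rw [Finset.prod_insert ha, Finset.sum_insert ha, ih, MvPolynomial.X, MvPolynomial.monomial_mul,
      one_mul]

theorem coeff_dominoPolynomial (lam : YoungDiagram) {m : ℕ} {μ : ℕ →₀ ℕ}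
    (hμ : μ.support ⊆ Finset.range m) :
    MvPolynomial.coeff μ (dominoPolynomial (fun i => (MvPolynomial.X i : MvPolynomial ℕ ℂ)) m lam) =
      dominoFunction lam μ := by
  classical
  rw [dominoPolynomial, MvPolynomial.coeff_sum]
  have h1 : ∀ T ∈ preTableaux lam m, MvPolynomial.coeff μ
      (if CornerCondition T then ∏ p ∈ T, (MvPolynomial.X p.2 : MvPolynomial ℕ ℂ) else 0) =
      if CornerCondition T ∧ weight T = μ then 1 else 0 := by
    intro T _
    rw [prod_X_eq_monomial, ite_and]
    split_ifs with h2 h3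
    · rw [MvPolynomial.coeff_monomial]
      exact if_pos h3
    · rw [MvPolynomial.coeff_monomial]
      exact if_neg h3
    · rw [MvPolynomial.coeff_zero]
  rw [Finset.sum_congr rfl h1, Finset.sum_boole, dominoFunction]
  congr 1
  rw [← Set.ncard_coe_finset]
  congr 1
  ext T
  simp only [Finset.coe_filter, mem_preTableaux, Set.mem_ofPred_eq, SSDT, isSSDT_iff]
  constructor
  · rintro ⟨⟨h2, -⟩, h3, h4⟩
    exact ⟨⟨h2, h3⟩, h4⟩
  · rintro ⟨⟨h2, h3⟩, h4⟩
    refine ⟨⟨h2, fun p hp => ?_⟩, h3, h4⟩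
    rw [← Finset.mem_range]
    refine hμ ?_
    rw [Finsupp.mem_support_iff, ← h4, weight, Finsupp.finsetSum_apply]
    refine Nat.ne_of_gt (Finset.sum_pos' (fun _ _ => Nat.zero_le _) ⟨p, hp, ?_⟩)
    simp

/-! ### Signed permutations and words -/

section SignedPerm

variable {n : ℕ}

/-- The absolute value of an element of `{-n, …, n}`. -/
def absPos (x : Set.Icc (-(n : ℤ)) (n : ℤ)) : Fin (n + 1) :=
  ⟨(x : ℤ).natAbs, by have := x.2.1; have := x.2.2; omega⟩

theorem absPos_val (x : Set.Icc (-(n : ℤ)) (n : ℤ)) : ((absPos x : Fin (n + 1)) : ℕ) =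
    (x : ℤ).natAbs := rfl

theorem pos_val (k : Fin (n + 1)) : ((pos k : Set.Icc (-(n : ℤ)) (n : ℤ)) : ℤ) = (k : ℕ) := rfl

theorem absPos_pos (k : Fin (n + 1)) : absPos (pos k) = k := rfl

theorem apply_pos_absPos (π : SignedPerm n) (x : Set.Icc (-(n : ℤ)) (n : ℤ)) :
    (π.1 (pos (absPos x)) : ℤ) = if (x : ℤ) < 0 then -(π.1 x : ℤ) else π.1 x := by
  split_ifs with h
  · refine π.2 x _ ?_
    rw [pos_val, absPos_val]
    omega
  · congr 2
    refine Subtype.ext ?_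
    rw [pos_val, absPos_val]
    omega

theorem apply_inv_apply (π : SignedPerm n) (x : Set.Icc (-(n : ℤ)) (n : ℤ)) :
    π.1 ((π⁻¹).1 x) = x := Equiv.apply_symm_apply π.1 x

theorem inv_apply_apply (π : SignedPerm n) (x : Set.Icc (-(n : ℤ)) (n : ℤ)) :
    (π⁻¹).1 (π.1 x) = x := Equiv.symm_apply_apply π.1 x

theorem signedPerm_zero (π : SignedPerm n) : (π.1 (pos 0) : ℤ) = 0 := by
  have := π.2 (pos 0) (pos 0) (by rw [pos_val]; simp)
  omega

theorem absPos_apply_injective (π : SignedPerm n) :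
    Function.Injective fun k => absPos (π.1 (pos k)) := by
  intro k l h
  have h1 := congrArg (fun k => (π⁻¹).1 (pos k)) h
  have h2 := apply_pos_absPos π⁻¹ (π.1 (pos k))
  have h3 := apply_pos_absPos π⁻¹ (π.1 (pos l))
  simp only at h1
  rw [inv_apply_apply, pos_val] at h2 h3
  rw [h1] at h2
  ext
  split_ifs at h2 h3 <;> omega

theorem signedPerm_ext {π π' : SignedPerm n} (h : ∀ k, (π.1 (pos k) : ℤ) = π'.1 (pos k)) :
    π = π' := by
  refine Subtype.ext (Equiv.ext fun x => Subtype.ext ?_)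
  have h1 := apply_pos_absPos π x
  have h2 := apply_pos_absPos π' x
  rw [h] at h1
  split_ifs at h1 h2 <;> omega

/-- The absolute values and signs on {0, …, n} can be prescribed; the rest is forced by oddness. -/
theorem exists_signedPerm (τ : Equiv.Perm (Fin (n + 1))) (V : Fin (n + 1) → ℤ)
    (hV : ∀ k, (V k).natAbs = τ k) (h0 : V 0 = 0) :
    ∃ π : SignedPerm n, ∀ k, (π.1 (pos k) : ℤ) = V k := by
  have hb : ∀ k, V k ∈ Set.Icc (-(n : ℤ)) n := by
    intro k
    have h1 := hV k
    have h2 := (τ k).2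
    constructor <;> omega
  have hb' : ∀ k, -V k ∈ Set.Icc (-(n : ℤ)) n := by
    intro k
    have := hb k
    constructor
    · have := this.2; omega
    · have := this.1; omega
  let f : Set.Icc (-(n : ℤ)) (n : ℤ) → Set.Icc (-(n : ℤ)) (n : ℤ) := fun x =>
    if (x : ℤ) < 0 then ⟨-V (absPos x), hb' _⟩ else ⟨V (absPos x), hb _⟩
  have hf : ∀ x, (f x : ℤ) = if (x : ℤ) < 0 then -V (absPos x) else V (absPos x) := by
    intro x
    simp only [f]
    split_ifs <;> rfl
  have hV0 : ∀ k, V k = 0 → k = 0 := by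
    intro k hk
    refine τ.injective (Fin.ext ?_)
    rw [← hV, ← hV, hk, h0]
  have hinj : Function.Injective f := by
    intro x y hxy
    have h1 := congrArg Subtype.val hxy
    rw [hf, hf] at h1
    have h2 : absPos x = absPos y := by
      refine τ.injective (Fin.ext ?_)
      rw [← hV, ← hV]
      split_ifs at h1 <;> omega
    have h3 : (x : ℤ).natAbs = (y : ℤ).natAbs := congrArg Fin.val h2
    rw [h2] at h1
    have h4 : V (absPos y) = 0 → (y : ℤ) = 0 := by
      intro h
      have := congrArg Fin.val (hV0 _ h)
      rw [absPos_val] at this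
      simpa using this
    refine Subtype.ext ?_
    split_ifs at h1 <;> omega
  have hbij : Function.Bijective f := Finite.injective_iff_bijective.mp hinj
  refine ⟨⟨Equiv.ofBijective f hbij, ?_⟩, ?_⟩
  · intro x y hxy
    simp only [Equiv.ofBijective_apply, hf]
    have h1 : absPos y = absPos x := by
      ext
      rw [absPos_val, absPos_val]
      omega
    rw [h1]
    by_cases hx : (x : ℤ) = 0
    · have h2 : absPos x = 0 := by
        ext
        rw [absPos_val]
        simp [hx]
      rw [h2, h0]
      simp
    · split_ifs <;> omega
  · intro k
    simp only [Equiv.ofBijective_apply, hf, absPos_pos]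
    rw [if_neg (by rw [pos_val]; omega)]

theorem mem_des {π : SignedPerm n} {j : ℕ} : j ∈ des π ↔ ∃ k : Fin n, (k : ℕ) = j ∧
    (π.1 (pos k.succ) : ℤ) < π.1 (pos k.castSucc) := by
  simp only [des, Finset.mem_map, Finset.mem_filter, Finset.mem_univ, true_and,
    Fin.valEmbedding_apply, gt_iff_lt]
  exact ⟨fun ⟨k, h, e⟩ => ⟨k, e, h⟩, fun ⟨k, e, h⟩ => ⟨k, h, e⟩⟩

theorem natCast_mem_des {π : SignedPerm n} {k : Fin n} : (k : ℕ) ∈ des π ↔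
    (π.1 (pos k.succ) : ℤ) < π.1 (pos k.castSucc) := by
  rw [mem_des]
  constructor
  · rintro ⟨l, hl, h⟩
    rwa [← Fin.ext hl]
  · intro h
    exact ⟨k, rfl, h⟩

/-- The pairs `(i k, π k)`, ordered lexicographically. -/
def lexKey (π : SignedPerm n) (i : Fin (n + 1) → ℕ) (k : Fin (n + 1)) : ℕ ×ₗ ℤ :=
  toLex (i k, (π.1 (pos k) : ℤ))

theorem lexKey_lt_iff {π : SignedPerm n} {i : Fin (n + 1) → ℕ} {k l : Fin (n + 1)} :
    lexKey π i k < lexKey π i l ↔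
      i k < i l ∨ i k = i l ∧ (π.1 (pos k) : ℤ) < π.1 (pos l) := by
  rw [lexKey, lexKey, Prod.Lex.toLex_lt_toLex]

/-- Successive values of π are distinct, so requiring a strict increase of i exactly at descents of
π means that the pairs (i_k, π(k)) increase lexicographically. -/
theorem mem_chowSeq_iff {π : SignedPerm n} {i : Fin (n + 1) → ℕ} {μ : ℕ →₀ ℕ} :
    i ∈ chowSeq n (des π) μ ↔ i 0 = 0 ∧ StrictMono (lexKey π i) ∧
      ∑ j : Fin n, Finsupp.single (i j.succ) 1 = μ := by
  rw [Fin.strictMono_iff_lt_succ]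
  simp only [chowSeq, Set.mem_ofPred_eq, natCast_mem_des, lexKey_lt_iff]
  have hne : ∀ j : Fin n, (π.1 (pos j.castSucc) : ℤ) ≠ π.1 (pos j.succ) := by
    intro j h
    have h1 := congrArg Subtype.val (π.1.injective (Subtype.ext h))
    simp only [pos_val] at h1
    simp at h1
  constructor
  · rintro ⟨h0, h1, h2, h3⟩
    refine ⟨h0, fun j => ?_, h3⟩
    have := h1 j; have := h2 j; have := hne j
    omega
  · rintro ⟨h0, h1, h3⟩
    refine ⟨h0, fun j => ?_, fun j hj => ?_, h3⟩
    · have := h1 j; omega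
    · have := h1 j; omega

/-- The word of a signed permutation and a sequence of letters: the letter at `|π k|` is `i k`, with
the sign of `π k`. -/
def extendedWord (π : SignedPerm n) (i : Fin (n + 1) → ℕ) (p : Fin (n + 1)) : ℤ :=
  if (((π⁻¹).1 (pos p) : Set.Icc (-(n : ℤ)) (n : ℤ)) : ℤ) < 0 then
    -(i (absPos ((π⁻¹).1 (pos p))) : ℤ) else i (absPos ((π⁻¹).1 (pos p)))

/-- The analogue of `lexKey` for words. -/
def wordKey (W : Fin (n + 1) → ℤ) (p : Fin (n + 1)) : ℕ ×ₗ ℤ :=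
  toLex ((W p).natAbs, if W p < 0 then -((p : ℕ) : ℤ) else (p : ℕ))

theorem natAbs_extendedWord (π : SignedPerm n) (i : Fin (n + 1) → ℕ) (p : Fin (n + 1)) :
    (extendedWord π i p).natAbs = i (absPos ((π⁻¹).1 (pos p))) := by
  unfold extendedWord
  split_ifs <;> simp

/-! ### Standardization of signed words -/

section Valid

variable {π : SignedPerm n} {i : Fin (n + 1) → ℕ} (h0 : i 0 = 0) (h : StrictMono (lexKey π i))
include h0 h

/-- The pair at k exceeds the pair (0, 0) at the origin. Hence a negative sign is never attached to
the letter 0, and the word retains all signs. -/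
theorem pos_of_apply_neg {k : Fin (n + 1)} (hk : (π.1 (pos k) : ℤ) < 0) : 0 < i k := by
  have h1 : k ≠ 0 := by
    rintro rfl
    rw [signedPerm_zero] at hk
    exact lt_irrefl _ hk
  have h2 := h (Fin.pos_iff_ne_zero.mpr h1)
  rw [lexKey_lt_iff, h0, signedPerm_zero] at h2
  omega

/-- The pairs (i_k, π(k)) can be read off from the word, up to their order, which is why (π, i) can
be recovered by sorting. -/
theorem lexKey_eq_wordKey (k : Fin (n + 1)) :
    lexKey π i k = wordKey (extendedWord π i) (absPos (π.1 (pos k))) := by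
  have h1 := apply_pos_absPos π⁻¹ (π.1 (pos k))
  rw [inv_apply_apply, pos_val] at h1
  have h2 : absPos ((π⁻¹).1 (pos (absPos (π.1 (pos k))))) = k := by
    ext
    rw [absPos_val, h1]
    split_ifs <;> simp
  have h3 : extendedWord π i (absPos (π.1 (pos k))) < 0 ↔ (π.1 (pos k) : ℤ) < 0 := by
    unfold extendedWord
    rw [h2, h1]
    constructor
    · intro h4
      by_contra h5
      rw [if_neg h5, if_neg (by omega)] at h4
      omega
    · intro h4
      have h5 := pos_of_apply_neg h0 h h4
      have h6 : k ≠ 0 := by rintro rfl; omega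
      have h7 := Fin.pos_iff_ne_zero.mpr h6
      rw [Fin.lt_def] at h7
      simp only [Fin.val_zero] at h7
      rw [if_pos h4, if_pos (by omega)]
      omega
  unfold lexKey wordKey
  rw [natAbs_extendedWord, h2]
  simp only [h3, absPos_val]
  congr 2
  split_ifs <;> omega

/-- The letter is a weakly increasing function of the value of π⁻¹, so only ties matter. Equal
letters have equal i, hence are ordered by π: equal non-negative letters have increasing values of
π⁻¹, and for equal negative letters the order is reversed twice. A tie is thus never a descent of
π⁻¹. -/
theorem extendedWord_lt_iff {p q : Fin (n + 1)} (hpq : p < q) :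
    extendedWord π i q < extendedWord π i p ↔
      (((π⁻¹).1 (pos q) : Set.Icc (-(n : ℤ)) (n : ℤ)) : ℤ) < (π⁻¹).1 (pos p) := by
  have e : ∀ p : Fin (n + 1), (π.1 (pos (absPos ((π⁻¹).1 (pos p)))) : ℤ) =
      if (((π⁻¹).1 (pos p) : Set.Icc (-(n : ℤ)) (n : ℤ)) : ℤ) < 0 then -((p : ℕ) : ℤ)
      else ((p : ℕ) : ℤ) := by
    intro p
    rw [apply_pos_absPos, apply_inv_apply, pos_val]
  have hp := e p
  have hq := e q
  have ap := absPos_val ((π⁻¹).1 (pos p))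
  have aq := absPos_val ((π⁻¹).1 (pos q))
  unfold extendedWord
  set u := (((π⁻¹).1 (pos p) : Set.Icc (-(n : ℤ)) (n : ℤ)) : ℤ)
  set v := (((π⁻¹).1 (pos q) : Set.Icc (-(n : ℤ)) (n : ℤ)) : ℤ)
  set k := absPos ((π⁻¹).1 (pos p))
  set l := absPos ((π⁻¹).1 (pos q))
  have hkl := h.lt_iff_lt (a := k) (b := l)
  have hlk := h.lt_iff_lt (a := l) (b := k)
  have hpk := pos_of_apply_neg h0 h (k := k)
  have hpl := pos_of_apply_neg h0 h (k := l)
  rw [lexKey_lt_iff, hp, hq, Fin.lt_def, ap, aq] at hkl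
  rw [lexKey_lt_iff, hp, hq, Fin.lt_def, ap, aq] at hlk
  rw [hp] at hpk
  rw [hq] at hpl
  have hpq' : (p : ℕ) < q := hpq
  split_ifs at * <;> omega

end Valid

theorem sum_extendedWord (π : SignedPerm n) (i : Fin (n + 1) → ℕ) :
    ∑ j : Fin n, Finsupp.single (extendedWord π i j.succ).natAbs 1 =
      ∑ j : Fin n, (Finsupp.single (i j.succ) 1 : ℕ →₀ ℕ) := by
  have h1 := (Finite.injective_iff_bijective.mp (absPos_apply_injective π⁻¹)).sum_comp
    fun k => (Finsupp.single (i k) 1 : ℕ →₀ ℕ)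
  rw [Fin.sum_univ_succ, Fin.sum_univ_succ] at h1
  have h2 : absPos ((π⁻¹).1 (pos 0)) = 0 := by
    ext
    rw [absPos_val, signedPerm_zero]
    rfl
  rw [h2] at h1
  simp only [natAbs_extendedWord]
  exact add_left_cancel h1

/-- The words of length `n` with descent set `J` and given weight. -/
def wordSet (n : ℕ) (J : Finset ℕ) (μ : ℕ →₀ ℕ) : Set (Fin n → ℤ) :=
  {w | (∀ j : Fin n, (j : ℕ) ∈ J ↔
      w j < (Fin.cons 0 w : Fin (n + 1) → ℤ) j.castSucc) ∧
    ∑ j : Fin n, Finsupp.single (w j).natAbs 1 = μ}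

theorem extendedWord_eq_cons {π : SignedPerm n} {i : Fin (n + 1) → ℕ} (h0 : i 0 = 0) :
    extendedWord π i = Fin.cons 0 fun j : Fin n => extendedWord π i j.succ := by
  funext p
  refine Fin.cases ?_ (fun j => ?_) p
  · have h2 : absPos ((π⁻¹).1 (pos 0)) = 0 := by
      ext
      rw [absPos_val, signedPerm_zero]
      rfl
    rw [extendedWord, signedPerm_zero, if_neg (lt_irrefl _), h2, h0]
    rfl
  · rfl

theorem eq_des_inv_iff {π : SignedPerm n} {i : Fin (n + 1) → ℕ} (h0 : i 0 = 0)
    (h : StrictMono (lexKey π i)) {J : Finset ℕ} (hJ : J ⊆ Finset.range n) :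
    des π⁻¹ = J ↔ ∀ j : Fin n, (j : ℕ) ∈ J ↔
      extendedWord π i j.succ < extendedWord π i j.castSucc := by
  simp only [extendedWord_lt_iff h0 h Fin.castSucc_lt_succ, ← natCast_mem_des]
  constructor
  · rintro rfl j
    rfl
  · intro h1
    ext j
    constructor
    · intro hj
      obtain ⟨k, rfl, -⟩ := mem_des.mp hj
      exact (h1 k).mpr hj
    · intro hj
      exact (h1 ⟨j, Finset.mem_range.mp (hJ hj)⟩).mp hj

theorem wordKey_injective (W : Fin (n + 1) → ℤ) : Function.Injective (wordKey W) := by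
  intro p q hpq
  have h1 := congrArg (fun z => (ofLex z).2) hpq
  simp only [wordKey, ofLex_toLex] at h1
  ext
  split_ifs at h1 <;> omega

theorem bijOn_extendedWord {J : Finset ℕ} (hJ : J ⊆ Finset.range n) (μ : ℕ →₀ ℕ) :
    Set.BijOn (fun q : SignedPerm n × (Fin (n + 1) → ℕ) => fun j : Fin n =>
        extendedWord q.1 q.2 j.succ)
      {q | q.1 ∈ inverseDescentClass n J ∧ q.2 ∈ chowSeq n (des q.1) μ} (wordSet n J μ) := by
  refine ⟨?_, ?_, ?_⟩
  · rintro ⟨π, i⟩ ⟨h1, h2⟩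
    obtain ⟨h0, h, hμ⟩ := mem_chowSeq_iff.mp h2
    refine ⟨?_, ?_⟩
    · rw [← extendedWord_eq_cons h0]
      exact (eq_des_inv_iff h0 h hJ).mp h1
    · simp only [sum_extendedWord]
      exact hμ
  · rintro ⟨π, i⟩ ⟨h1, h2⟩ ⟨π', i'⟩ ⟨h1', h2'⟩ e
    obtain ⟨h0, h, -⟩ := mem_chowSeq_iff.mp h2
    obtain ⟨h0', h', -⟩ := mem_chowSeq_iff.mp h2'
    simp only at e h0 h h0' h'
    have e' : extendedWord π i = extendedWord π' i' := by
      rw [extendedWord_eq_cons h0, e, ← extendedWord_eq_cons h0']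
    have hr : ∀ {π : SignedPerm n} {i : Fin (n + 1) → ℕ}, i 0 = 0 → StrictMono (lexKey π i) →
        Set.range (lexKey π i) = Set.range (wordKey (extendedWord π i)) := by
      intro π i h0 h
      have : lexKey π i = wordKey (extendedWord π i) ∘ fun k => absPos (π.1 (pos k)) :=
        funext (lexKey_eq_wordKey h0 h)
      rw [this]
      exact (Finite.injective_iff_surjective.mp (absPos_apply_injective π)).range_comp _
    -- A strictly increasing sequence is determined by its range, and the word determines this
    -- range.
    have hk : lexKey π i = lexKey π' i' := by
      rw [← h.range_inj h', hr h0 h, hr h0' h', e']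
    have hk' : ∀ k, i k = i' k ∧ (π.1 (pos k) : ℤ) = π'.1 (pos k) := by
      intro k
      have := congrArg ofLex (congrFun hk k)
      simp only [lexKey, ofLex_toLex, Prod.mk.injEq] at this
      exact this
    rw [signedPerm_ext fun k => (hk' k).2, funext fun k => (hk' k).1]
  · rintro w ⟨hw, hμ⟩
    set W : Fin (n + 1) → ℤ := Fin.cons 0 w with hW
    have hW0 : W 0 = 0 := rfl
    -- Sorting the positions by key gives |π|; the signs of π are those of the letters.
    set τ := Tuple.sort (wordKey W) with hτ
    have hmono : StrictMono (wordKey W ∘ τ) :=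
      (Tuple.monotone_sort (wordKey W)).strictMono_of_injective
        ((wordKey_injective W).comp τ.injective)
    have hmin : ∀ p, wordKey W 0 ≤ wordKey W p := by
      intro p
      unfold wordKey
      rw [Prod.Lex.toLex_le_toLex, hW0]
      simp only [Int.natAbs_zero, lt_irrefl, if_false, Fin.val_zero]
      rcases Nat.eq_zero_or_pos (W p).natAbs with h | h
      · right
        refine ⟨h.symm, ?_⟩
        rw [if_neg (by omega)]
        simp
      · exact Or.inl h
    -- The added letter 0 has the least key (0, 0), so position 0 stays first and π fixes 0.
    have hτ0 : τ 0 = 0 := by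
      refine wordKey_injective W (le_antisymm ?_ (hmin _))
      have := hmono.monotone (Fin.zero_le (τ.symm 0))
      simpa using this
    obtain ⟨π, hπ⟩ := exists_signedPerm τ
      (fun k => if W (τ k) < 0 then -((τ k : ℕ) : ℤ) else (τ k : ℕ))
      (by intro k; split_ifs <;> simp)
      (by simp [hτ0])
    set i : Fin (n + 1) → ℕ := fun k => (W (τ k)).natAbs with hi
    have hkey : lexKey π i = wordKey W ∘ τ := by
      funext k
      simp only [lexKey, hπ, Function.comp, wordKey, hi]
    have h0 : i 0 = 0 := by simp [hi, hτ0, hW0]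
    have h : StrictMono (lexKey π i) := by rw [hkey]; exact hmono
    have hword : extendedWord π i = W := by
      funext p
      obtain ⟨k, rfl⟩ := τ.surjective p
      have h1 : absPos (π.1 (pos k)) = τ k := by
        ext
        rw [absPos_val, hπ]
        split_ifs <;> simp
      have h2 := lexKey_eq_wordKey h0 h k
      rw [h1, hkey] at h2
      have h3 := congrArg (fun z => (ofLex z).1) h2
      have h4 := congrArg (fun z => (ofLex z).2) h2
      simp only [wordKey, Function.comp, ofLex_toLex] at h3 h4
      by_cases hk : τ k = 0
      · rw [hk, hW0, extendedWord_eq_cons h0]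
        rfl
      · have h5 := Fin.pos_iff_ne_zero.mpr hk
        rw [Fin.lt_def] at h5
        simp only [Fin.val_zero] at h5
        split_ifs at h4 <;> omega
    refine ⟨(π, i), ⟨?_, ?_⟩, ?_⟩
    · refine (eq_des_inv_iff h0 h hJ).mpr ?_
      rw [hword]
      exact hw
    · rw [mem_chowSeq_iff]
      refine ⟨h0, h, ?_⟩
      rw [← sum_extendedWord, hword]
      exact hμ
    · simp only [hword]
      rfl

theorem quasi_inverseDescentClass {J : Finset ℕ} (hJ : J ⊆ Finset.range n) (μ : ℕ →₀ ℕ) :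
    MvPowerSeries.coeff μ (quasi (inverseDescentClass n J)) = ((wordSet n J μ).ncard : ℂ) := by
  classical
  have h1 := (bijOn_extendedWord hJ μ).ncard_eq
  rw [← h1, quasi]
  have h2 : {q : SignedPerm n × (Fin (n + 1) → ℕ) |
      q.1 ∈ inverseDescentClass n J ∧ q.2 ∈ chowSeq n (des q.1) μ} =
      (((Set.toFinite (inverseDescentClass n J)).toFinset.sigma
        fun π => (chowSeq_finite n (des π) μ).toFinset).map
          (Equiv.sigmaEquivProd _ _).toEmbedding : Finset _) := by
    ext ⟨π, i⟩
    simp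
  rw [h2, Set.ncard_coe_finset, Finset.card_map, Finset.card_sigma]
  rw [map_sum]
  push_cast
  refine Finset.sum_congr rfl fun π _ => ?_
  rw [← Set.ncard_eq_toFinset_card _ (chowSeq_finite n (des π) μ)]
  rfl

end SignedPerm

/-! ### Comparison of coefficients -/

theorem wordSystem_pathSum_ofFn {R : Type} [CommRing R] (x : ℤ → R) (s : Finset ℤ) {n : ℕ}
    (d : Fin n → Bool) (a : Option ℤ) (z : R) :
    (wordSystem x s).pathSum (fun w : R => w) (List.ofFn fun i => some (d i)) a z =
      (∑ w ∈ (Fintype.piFinset fun _ : Fin n => s).filter fun w => ∀ i : Fin n, d i = true ↔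
        (Fin.cons (a.getD 0) w : Fin (n + 1) → ℤ) i.castSucc ≤ w i, ∏ i, x (w i)) * z := by
  classical
  induction n generalizing a z with
  | zero =>
    simp only [List.ofFn_zero, PathSystem.pathSum]
    rw [Finset.filter_true_of_mem (fun w _ i => i.elim0)]
    simp
  | succ n ih =>
    rw [List.ofFn_succ, PathSystem.pathSum]
    have e : ∀ b : ℤ, (wordSystem x s).pathSum (fun w : R => w)
        (List.ofFn fun i : Fin n => some (d i.succ)) (some b) (x b * z) =
        (∑ w ∈ (Fintype.piFinset fun _ : Fin n => s).filter fun w => ∀ i : Fin n, d i.succ = true ↔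
          (Fin.cons b w : Fin (n + 1) → ℤ) i.castSucc ≤ w i, x b * ∏ i, x (w i)) * z := by
      intro b
      rw [ih (fun i => d i.succ) (some b) (x b * z), ← Finset.mul_sum]
      simp only [Option.getD_some]
      ring
    refine (Finset.sum_congr rfl fun b _ => e b).trans ?_
    rw [← Finset.sum_mul, Finset.sum_sigma']
    congr 1
    refine Finset.sum_bij' (fun p _ => Fin.cons p.1 p.2) (fun w _ => ⟨w 0, Fin.tail w⟩)
      ?_ ?_ ?_ ?_ ?_
    · rintro ⟨b, w⟩ h
      simp only [Finset.mem_sigma, Finset.mem_filter, Fintype.mem_piFinset, PathSystem.Allows,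
        Option.mem_some_iff] at h ⊢
      obtain ⟨⟨hb, h1⟩, hw, h2⟩ := h
      refine ⟨fun i => ?_, fun i => ?_⟩
      · refine Fin.cases ?_ (fun j => ?_) i
        · exact hb
        · simpa using hw j
      · refine Fin.cases ?_ (fun j => ?_) i
        · simpa using h1 _ rfl
        · simpa using h2 j
    · intro w h
      simp only [Finset.mem_sigma, Finset.mem_filter, Fintype.mem_piFinset, PathSystem.Allows,
        Option.mem_some_iff] at h ⊢
      obtain ⟨hw, h1⟩ := h
      refine ⟨⟨hw 0, ?_⟩, fun i => hw i.succ, fun i => ?_⟩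
      · rintro c rfl
        simpa using h1 0
      · have := h1 i.succ
        rw [← Fin.succ_castSucc, Fin.cons_succ] at this
        rw [this, show (Fin.cons (w 0) (Fin.tail w) : Fin (n + 1) → ℤ) = w from Fin.cons_self_tail w]
        rfl
    · rintro ⟨b, w⟩ _
      simp
    · intro w _
      simp
    · rintro ⟨b, w⟩ _
      simp [Fin.prod_univ_succ]

/-- The descent conditions which define the descent set `J`. -/
def descentConditions (n : ℕ) (J : Finset ℕ) : List (Option Bool) :=
  List.ofFn fun i : Fin n => some (decide ((i : ℕ) ∉ J))

/-- Truncating the alphabet loses nothing, because the absolute values of the letters of a word of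
weight `μ` lie in the support of `μ`. -/
theorem coeff_wordSystem_pathSum (n m : ℕ) (J : Finset ℕ) {μ : ℕ →₀ ℕ}
    (hμ : μ.support ⊆ Finset.range (m + 1)) :
    MvPolynomial.coeff μ ((wordSystem (fun i : ℤ => (MvPolynomial.X i.natAbs : MvPolynomial ℕ ℂ))
      (Finset.Icc (-(m : ℤ)) m)).pathSum (fun w : MvPolynomial ℕ ℂ => w) (descentConditions n J)
        none 1) = ((wordSet n J μ).ncard : ℂ) := by
  classical
  rw [descentConditions, wordSystem_pathSum_ofFn, mul_one, MvPolynomial.coeff_sum]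
  simp_rw [prod_X_eq_monomial, MvPolynomial.coeff_monomial]
  rw [Finset.sum_boole, ← Set.ncard_coe_finset]
  congr 2
  ext w
  simp only [Finset.coe_filter, Finset.mem_filter, Fintype.mem_piFinset, Set.mem_ofPred_eq, wordSet,
    Option.getD_none, decide_eq_true_eq]
  constructor
  · rintro ⟨⟨-, h1⟩, h2⟩
    refine ⟨fun j => ?_, h2⟩
    rw [← not_le, ← h1 j, not_not]
  · rintro ⟨h1, h2⟩
    refine ⟨⟨fun j => ?_, fun j => ?_⟩, h2⟩
    · have h3 : (w j).natAbs ∈ Finset.range (m + 1) := by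
        refine hμ ?_
        rw [Finsupp.mem_support_iff, ← h2, Finsupp.finsetSum_apply]
        refine Nat.ne_of_gt (Finset.sum_pos' (fun _ _ => Nat.zero_le _) ⟨j, Finset.mem_univ _, ?_⟩)
        simp
      rw [Finset.mem_range] at h3
      rw [Finset.mem_Icc]
      omega
    · rw [h1 j, not_lt]

/-- Steps from a pair of partitions lead to pairs of partitions, and each of them adds one box. -/
theorem tableauSystem_pathSum_congr {M : Type*} [AddCommMonoid M]
    {f g : (ℕ →₀ ℕ) × (ℕ →₀ ℕ) → M} (ds : List (Option Bool)) (o : Option (ℕ ⊕ ℕ))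
    {a b : ℕ →₀ ℕ} (ha : Antitone a) (hb : Antitone b)
    (h : ∀ a' b' : ℕ →₀ ℕ, Antitone a' → Antitone b' →
      a'.degree + b'.degree = a.degree + b.degree + ds.length → f (a', b') = g (a', b')) :
    tableauSystem.pathSum f ds o (a, b) = tableauSystem.pathSum g ds o (a, b) := by
  classical
  induction ds generalizing o a b with
  | nil => exact h a b ha hb rfl
  | cons d ds ih =>
    rw [PathSystem.pathSum, PathSystem.pathSum]
    refine Finset.sum_congr rfl fun c hc => ?_
    have hc' := (Finset.mem_filter.mp hc).1
    simp only [ha, hb, and_self, if_true] at hc'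
    rcases c with r | r
    · rw [Finset.inl_mem_disjSum, mem_addable] at hc'
      refine ih _ ha hc' fun a' b' ha' hb' hd => h a' b' ha' hb' ?_
      rw [hd, degree_addBox, List.length_cons]
      ring
    · rw [Finset.inr_mem_disjSum, mem_addable] at hc'
      refine ih _ hc' hb fun a' b' ha' hb' hd => h a' b' ha' hb' ?_
      rw [hd, degree_addBox, List.length_cons]
      ring

/-- The coefficients of the inverse descent class of `J` on the domino functions: the numbers of
standard bitableaux with descent set `J`. -/
noncomputable def descentMultiplicity (n : ℕ) (J : Finset ℕ) : YoungDiagram →₀ ℕ :=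
  tableauSystem.pathSum (fun z => Finsupp.single (dominoShape z) 1) (descentConditions n J) none
    (0, 0)

theorem mem_P0_of_mem_support {n : ℕ} {J : Finset ℕ} {lam : YoungDiagram}
    (h : lam ∈ (descentMultiplicity n J).support) : lam ∈ P0 n := by
  by_contra hlam
  rw [Finsupp.mem_support_iff] at h
  apply h
  have h0 : Antitone (0 : ℕ →₀ ℕ) := fun _ _ _ => le_rfl
  have h1 := PathSystem.map_pathSum (S := tableauSystem) (Finsupp.applyAddHom (M := ℕ) lam)
    (fun z => Finsupp.single (dominoShape z) 1) (descentConditions n J) none (0, 0)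
  -- The zero homomorphism shows that the path sum of the zero function is zero.
  have h2 := PathSystem.map_pathSum (S := tableauSystem) (0 : ℕ →+ ℕ) (fun _ => 0)
    (descentConditions n J) none (0, 0)
  refine h1.trans (Eq.trans ?_ h2.symm)
  refine tableauSystem_pathSum_congr _ _ h0 h0 fun a b ha hb hd => ?_
  simp only [map_zero, zero_add, descentConditions, List.length_ofFn] at hd
  have h3 := dominoShape_mem_P0 ha hb
  rw [hd] at h3
  have h4 : dominoShape (a, b) ≠ lam := fun e => hlam (e ▸ h3)
  simp [Finsupp.single_eq_of_ne h4.symm]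

theorem sum_descentMultiplicity {R : Type} [CommRing R] (x : ℕ → R) (n m : ℕ) (J : Finset ℕ) :
    (descentMultiplicity n J).sum (fun lam k => k • dominoPolynomial x (m + 1) lam) =
      tableauSystem.pathSum (bischur x m) (descentConditions n J) none (0, 0) := by
  have h0 : Antitone (0 : ℕ →₀ ℕ) := fun _ _ _ => le_rfl
  -- Path sums commute with additive maps, here the one sending each diagram to its domino
  -- polynomial.
  have h1 := PathSystem.map_pathSum (S := tableauSystem)
    (Finsupp.liftAddHom fun lam => (smulAddHom ℕ R).flip (dominoPolynomial x (m + 1) lam))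
    (fun z => Finsupp.single (dominoShape z) 1) (descentConditions n J) none (0, 0)
  refine h1.trans (tableauSystem_pathSum_congr _ _ h0 h0 fun a b ha hb _ => ?_)
  rw [← dominoPolynomial_eq_bischur x m ha hb]
  simp

theorem coeff_quasi_inverseDescentClass {n : ℕ} {J : Finset ℕ} (hJ : J ⊆ Finset.range n)
    (μ : ℕ →₀ ℕ) : MvPowerSeries.coeff μ (quasi (inverseDescentClass n J)) =
      ∑ lam ∈ (descentMultiplicity n J).support,
        (descentMultiplicity n J lam : ℂ) * dominoFunction lam μ := by
  -- One coefficient involves finitely many variables, so the polynomial identity for a suitable `m`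
  -- suffices; the multiplicities are the same for all `m`.
  obtain ⟨m, hm⟩ : ∃ m, μ.support ⊆ Finset.range (m + 1) := by
    obtain ⟨m, hm⟩ := μ.support.bddAbove
    exact ⟨m, fun i hi => Finset.mem_range.mpr (Nat.lt_succ_of_le (hm hi))⟩
  rw [quasi_inverseDescentClass hJ, ← coeff_wordSystem_pathSum n m J hm,
    ← pathSum_tableauSystem_eq, ← sum_descentMultiplicity, Finsupp.sum, MvPolynomial.coeff_sum]
  refine Finset.sum_congr rfl fun lam _ => ?_
  rw [MvPolynomial.coeff_smul, coeff_dominoPolynomial lam hm, nsmul_eq_mul]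

end TypeB

theorem mainTheorem7 (n : ℕ) (J : Finset ℕ) (hJ : J ⊆ {0} ∪ Finset.Icc 1 n) :
    TypeB.GPositive (TypeB.inverseDescentClass n J) := by
  by_cases h : J ⊆ Finset.range n
  · refine ⟨TypeB.descentMultiplicity n J, fun lam => TypeB.mem_P0_of_mem_support, ?_⟩
    refine MvPowerSeries.ext fun μ => ?_
    rw [TypeB.coeff_quasi_inverseDescentClass h, map_sum]
    refine Finset.sum_congr rfl fun lam _ => ?_
    rw [map_smul, smul_eq_mul]
    rfl
  -- Descents are at most n - 1, so the class is empty if `n ∈ J`, and zero coefficients do.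
  · have he : TypeB.inverseDescentClass n J = ∅ := by
      rw [Set.eq_empty_iff_forall_notMem]
      rintro π hπ
      refine h fun j hj => ?_
      rw [← show TypeB.des π⁻¹ = J from hπ] at hj
      obtain ⟨k, rfl, -⟩ := TypeB.mem_des.mp hj
      exact Finset.mem_range.mpr k.2
    refine ⟨0, by simp, ?_⟩
    rw [he]
    simp [TypeB.quasi]
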